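/- **Definitions.** A Borel probability measure $\mu$ on $\mathbb R$ and a countable set $\Lambda\subset\mathbb R$ form a *spectral pair* $(\mu,\Lambda)$ if $\{e^{2\pi i\lambda x}:\lambda\in\Lambda\}$ is an orthonormal basis of $L^2(\mu)$. A real number $t$ is a *spectral eigenvalue* of the spectral pair $(\mu,\Lambda)$ if $(\mu,t\Lambda)$ is also a spectral pair. Let $N\ge 2$ be an integer and let $B,L\subset\mathbb Z$ be finite sets with $\#B=\#L\ge 2$; $(N,B,L)$ is a *Hadamard triple* if the matrix $\big(\tfrac1{\sqrt{\#B}}e^{2\pi i b\ell/N}\big)_{b\in B,\ell\in L}$ is unitary. Write $\tau_c(x)=(x+c)/N$, let $\mu_{N,B}$ be the unique Borel probability measure with $\mu=\frac1{\#B}\sum_{b\in B}\mu\circ\tau_b^{-1}$, and let $m_B(x)=\frac1{\#B}\sum_{b\in B}e^{2\pi i bx}$. If moreover $0\in B\cap L$, an *$m_B$-cycle* is a finite set $C=\{x_1,\dots,x_k\}$ ($k\ge1$) with $|m_B(x_j)|=1$ for all $j$ for which there are $\ell_1,\dots,\ell_k\in L$ such that $\tau_{\ell_j}(x_j)=x_{j+1}$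 for $1\le j<k$ and $\tau_{\ell_k}(x_k)=x_1$. Let $\Lambda$ be the smallest subset of $\mathbb R$ that contains $-C$ for every $m_B$-cycle $C$ and satisfies $N\Lambda+L\subset\Lambda$. Then $(\mu_{N,B},\Lambda)$ is a spectral pair, called the *canonical spectral pair* generated by $(N,B,L)$. **Artin's primitive root conjecture.** For every integer $a\ge2$ that is not a perfect square there are infinitely many primes $p\nmid a$ such that the order of $a$ modulo $p$ is $p-1$. **Elliott–Halberstam conjecture.** For all $0<\theta<1$ and $A>0$ there is a constant $C>0$ such that $$\sum_{1\le q\le x^\theta}\ \max_{y\le x}\ \max_{\gcd(a,q)=1}\Big|\pi(y;q,a)-\frac{\pi(y)}{\varphi(q)}\Big|\le\frac{Cx}{(\log x)^A}\qquad\text{for all }x>2,$$ where $\pi(y)$ is the number of primes $p\le y$, $\pi(y;q,a)$ is the number of primes $p\le y$ with $p\equiv a \pmod q$, and $\varphi$ is Euler's totient function. **Theorem 2.** Assume Artin's primitive root conjecture or the Elliott–Halberstam conjecture. Let $(N,B,L)$ be a Hadamard triple in $\mathbb R$ with $0\in B\cap L$, and let $(\mu_{N,B},\Lambda)$ be the canonical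 spectral pair generated by it. Then $\mu_{N,B}$ is singular continuous (it has no atoms and is singular with respect to Lebesgue measure) if and only if $\#B<N$; and if $\mu_{N,B}$ is singular continuous, then there are infinitely many primes $p$ that are spectral eigenvalues of $(\mu_{N,B},\Lambda)$. -/

import Mathlib

open MeasureTheory

/-! ### Hadamard triples and self-similar measures -/

/-- The map `τ_c(x) = (x + c) / N` of the iterated function systems attached to `N`. -/
noncomputable def ifsMap (N : ℕ) (c : ℤ) (x : ℝ) : ℝ := (x + c) / N

/-- The matrix `((#B)^{-1/2} e^{2πi bℓ/N})`, with rows `b ∈ B` and columns `ℓ ∈ L`. -/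
noncomputable def hadamardMatrix (N : ℕ) (B L : Finset ℤ) : Matrix B L ℂ :=
  fun b l => ((1 / Real.sqrt (B.card : ℝ) : ℝ) : ℂ) *
    Complex.exp (2 * Real.pi * Complex.I * ((b : ℤ) * (l : ℤ) / N))

/-- `(N, B, L)` is a Hadamard triple in `ℝ`. -/
structure IsHadamardTriple (N : ℕ) (B L : Finset ℤ) : Prop where
  two_le : 2 ≤ N
  card_eq : B.card = L.card
  two_le_card : 2 ≤ B.card
  mul_conjTranspose : hadamardMatrix N B L * (hadamardMatrix N B L).conjTranspose = 1
  conjTranspose_mul : (hadamardMatrix N B L).conjTranspose * hadamardMatrix N B L = 1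

/-- `μ` is a Borel probability measure with `μ = (#B)⁻¹ ∑_{b ∈ B} μ ∘ τ_b⁻¹`. -/
def IsSelfSimilarMeasure (N : ℕ) (B : Finset ℤ) (μ : Measure ℝ) : Prop :=
  IsProbabilityMeasure μ ∧ μ = (B.card : ENNReal)⁻¹ • ∑ b ∈ B, μ.map (ifsMap N b)

theorem measurable_ifsMap (N : ℕ) (c : ℤ) : Measurable (ifsMap N c) := by
  unfold ifsMap; fun_prop

theorem exists_isSelfSimilarMeasure (N : ℕ) (hN : 2 ≤ N) (B : Finset ℤ) (hB : B.Nonempty) :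
    ∃ μ : Measure ℝ, IsSelfSimilarMeasure N B μ := by
  classical
  have hB0 : (B.card : ENNReal) ≠ 0 := by simpa using hB.ne_empty
  have hBt : (B.card : ENNReal) ≠ ⊤ := by simp
  have hN0 : (N : ℝ) ≠ 0 := by positivity
  let Q : Measure B := (B.card : ENNReal)⁻¹ • Measure.count
  have hQ : IsProbabilityMeasure Q := ⟨by
    simp [Q, ENNReal.inv_mul_cancel hB0 hBt]⟩
  let P : Measure (ℕ → B) := Measure.infinitePi fun _ => Q
  let X : (ℕ → B) → ℝ := fun ω => ∑' k, ((ω k : ℤ) : ℝ) * ((N : ℝ)⁻¹) ^ (k + 1)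
  obtain ⟨M, hM⟩ : ∃ M : ℝ, ∀ b : B, ‖((b : ℤ) : ℝ)‖ ≤ M := by
    obtain ⟨M, hM⟩ := (Set.finite_range fun b : B => ‖((b : ℤ) : ℝ)‖).bddAbove
    exact ⟨M, fun b => hM ⟨b, rfl⟩⟩
  have hgeo : Summable fun k : ℕ => M * ((N : ℝ)⁻¹) ^ (k + 1) := by
    have h1 : ((N : ℝ)⁻¹) < 1 := inv_lt_one_of_one_lt₀ (by exact_mod_cast hN)
    exact (((summable_nat_add_iff 1).2
      (summable_geometric_of_lt_one (by positivity) h1))).mul_left M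
  have hbd : ∀ (k : ℕ) (ω : ℕ → B),
      ‖((ω k : ℤ) : ℝ) * ((N : ℝ)⁻¹) ^ (k + 1)‖ ≤ M * ((N : ℝ)⁻¹) ^ (k + 1) := by
    intro k ω
    rw [norm_mul, norm_pow, norm_inv, Real.norm_natCast]
    gcongr
    exact hM _
  have hsum : ∀ ω : ℕ → B, Summable fun k => ((ω k : ℤ) : ℝ) * ((N : ℝ)⁻¹) ^ (k + 1) :=
    fun ω => Summable.of_norm_bounded hgeo fun k => hbd k ω
  have hXc : Continuous X := by
    refine continuous_tsum (fun k => ?_) hgeo hbd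
    have : Continuous fun b : B => ((b : ℤ) : ℝ) := continuous_of_discreteTopology
    exact (this.comp (continuous_apply k)).mul continuous_const
  have hXm : Measurable X := hXc.measurable
  let c : B × (ℕ → B) → (ℕ → B) := fun z k => Nat.casesOn k z.1 z.2
  have hcm : Measurable c := by
    refine measurable_pi_lambda _ fun k => ?_
    cases k with
    | zero => exact measurable_fst
    | succ k => exact (measurable_pi_apply k).comp measurable_snd
  have hXcons : ∀ z, X (c z) = ifsMap N (z.1 : ℤ) (X z.2) := by
    intro z
    have h := (hsum (c z)).tsum_eq_zero_add
    simp only [X, ifsMap]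
    rw [h, add_div, ← tsum_div_const, add_comm]
    congr 1
    · refine tsum_congr fun k => ?_
      simp only [c]
      rw [pow_succ _ (k + 1)]
      field_simp
    · simp [c, div_eq_mul_inv]
  have hPc : (Q.prod P).map c = P := by
    refine Measure.eq_infinitePi _ fun s t ht => ?_
    rw [Measure.map_apply hcm (MeasurableSet.pi s.countable_toSet fun i _ => ht i)]
    let t' : ℕ → Set B := fun i => if i ∈ s then t i else Set.univ
    obtain ⟨n, hn⟩ : ∃ n, s ⊆ Finset.range (n + 1) := by
      obtain ⟨n, hn⟩ := s.exists_nat_subset_range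
      exact ⟨n, hn.trans (Finset.range_mono (Nat.le_succ n))⟩
    have hset : c ⁻¹' (Set.pi s t)
        = t' 0 ×ˢ Set.pi (Finset.range n : Finset ℕ) fun i => t' (i + 1) := by
      ext z
      simp only [Set.mem_preimage, Set.mem_pi, Finset.mem_coe, Set.mem_prod, Finset.mem_range]
      constructor
      · intro h
        refine ⟨?_, fun i _ => ?_⟩
        · by_cases h0 : 0 ∈ s
          · simpa [t', h0, c] using h 0 h0
          · simp [t', h0]
        · by_cases h0 : i + 1 ∈ s
          · simpa [t', h0] using h (i + 1) h0
          · simp [t', h0]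
      · rintro ⟨h0, h1⟩ i hi
        cases i with
        | zero => simpa [t', hi, c] using h0
        | succ i =>
          have : i < n := by simpa using hn hi
          simpa [t', hi] using h1 i this
    have ht' : ∀ i, MeasurableSet (t' i) := fun i => by
      by_cases h : i ∈ s
      · simpa [t', h] using ht i
      · simp [t', h]
    rw [hset, Measure.prod_prod, Measure.infinitePi_pi _ fun i _ => ht' (i + 1), mul_comm,
      ← Finset.prod_range_succ' (fun i => Q (t' i)) n]
    rw [← Finset.prod_subset hn]
    · exact Finset.prod_congr rfl fun i hi => by simp [t', hi]
    · intro i _ hi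
      simp [t', hi]
  refine ⟨P.map X, Measure.isProbabilityMeasure_map hXm.aemeasurable, ?_⟩
  ext S hS
  rw [Measure.map_apply hXm hS]
  conv_lhs => rw [← hPc]
  rw [Measure.map_apply hcm (hXm hS), Measure.prod_apply (hcm (hXm hS))]
  simp only [Q, lintegral_smul_measure, lintegral_count, tsum_fintype, Measure.smul_apply,
    Measure.finsetSum_apply]
  rw [← Finset.sum_coe_sort B]
  congr 1
  refine Finset.sum_congr rfl fun b _ => ?_
  rw [Measure.map_apply (measurable_ifsMap N b) hS,
    Measure.map_apply hXm (measurable_ifsMap N b hS)]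
  congr 1
  ext ω
  simp [hXcons]

theorem IsSelfSimilarMeasure.charFun_eq {N : ℕ} {B : Finset ℤ} {μ : Measure ℝ}
    (h : IsSelfSimilarMeasure N B μ) (t : ℝ) :
    charFun μ t = (B.card : ℂ)⁻¹ *
      ∑ b ∈ B, Complex.exp (t * (b / N) * Complex.I) * charFun μ (t / N) := by
  have := h.1
  have hi : ∀ b ∈ B, Integrable (fun x : ℝ => Complex.exp (t * x * Complex.I))
      (μ.map (ifsMap N b)) := by
    intro b _
    have := Measure.isProbabilityMeasure_map (μ := μ) (measurable_ifsMap N b).aemeasurable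
    refine (integrable_const (1 : ℝ)).mono' (by fun_prop) (Filter.Eventually.of_forall fun x => ?_)
    rw [← Complex.ofReal_mul, Complex.norm_exp_ofReal_mul_I]
  have key : ∫ x, Complex.exp (t * x * Complex.I) ∂μ
      = ∫ x, Complex.exp (t * x * Complex.I)
        ∂((B.card : ENNReal)⁻¹ • ∑ b ∈ B, μ.map (ifsMap N b)) := by
    rw [← h.2]
  rw [charFun_apply_real, key, integral_smul_measure, integral_finsetSum_measure hi]
  rw [ENNReal.toReal_inv, ENNReal.toReal_natCast, Complex.real_smul]
  push_cast
  congr 1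
  refine Finset.sum_congr rfl fun b _ => ?_
  rw [integral_map (measurable_ifsMap N b).aemeasurable (by fun_prop), charFun_apply_real,
    ← integral_const_mul]
  refine integral_congr_ae (Filter.Eventually.of_forall fun x => ?_)
  simp only [ifsMap]
  rw [← Complex.exp_add]
  congr 1
  push_cast
  ring

theorem IsSelfSimilarMeasure.unique {N : ℕ} (hN : 2 ≤ N) {B : Finset ℤ} {μ ν : Measure ℝ}
    (hμ : IsSelfSimilarMeasure N B μ) (hν : IsSelfSimilarMeasure N B ν) : μ = ν := by
  have := hμ.1
  have := hν.1
  have step : ∀ t : ℝ, ‖charFun μ t - charFun ν t‖ ≤ ‖charFun μ (t / N) - charFun ν (t / N)‖ := by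
    intro t
    rw [hμ.charFun_eq t, hν.charFun_eq t, ← mul_sub, ← Finset.sum_sub_distrib, norm_mul]
    have h1 : ‖∑ b ∈ B, (Complex.exp (t * (b / N) * Complex.I) * charFun μ (t / N)
        - Complex.exp (t * (b / N) * Complex.I) * charFun ν (t / N))‖
        ≤ ∑ b ∈ B, ‖charFun μ (t / N) - charFun ν (t / N)‖ := by
      refine norm_sum_le_of_le _ fun b _ => ?_
      rw [← mul_sub, norm_mul]
      have : ‖Complex.exp (t * (b / N) * Complex.I)‖ = 1 := by
        have := Complex.norm_exp_ofReal_mul_I (t * (b / N))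
        push_cast at this
        exact this
      rw [this, one_mul]
    rw [Finset.sum_const, nsmul_eq_mul] at h1
    rw [norm_inv, Complex.norm_natCast]
    refine (mul_le_mul_of_nonneg_left h1 (by positivity)).trans ?_
    rw [← mul_assoc]
    exact mul_le_of_le_one_left (norm_nonneg _) inv_mul_le_one
  have iter : ∀ (n : ℕ) (t : ℝ), ‖charFun μ t - charFun ν t‖
      ≤ ‖charFun μ (t / (N : ℝ) ^ n) - charFun ν (t / (N : ℝ) ^ n)‖ := by
    intro n t
    induction n with
    | zero => simp
    | succ n ih =>
      refine ih.trans ((step _).trans (le_of_eq ?_))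
      rw [div_div, ← pow_succ]
  refine Measure.ext_of_charFun (funext fun t => ?_)
  have hlim : Filter.Tendsto (fun n : ℕ => t / (N : ℝ) ^ n) Filter.atTop (nhds 0) :=
    (tendsto_pow_atTop_atTop_of_one_lt (by exact_mod_cast hN)).const_div_atTop t
  have hc : Continuous fun t : ℝ => ‖charFun μ t - charFun ν t‖ :=
    (continuous_charFun.sub continuous_charFun).norm
  have h0 := (hc.tendsto 0).comp hlim
  simp only [charFun_zero, probReal_univ, sub_self, norm_zero] at h0
  have := ge_of_tendsto' h0 fun n => iter n t
  exact sub_eq_zero.1 (norm_le_zero_iff.1 this)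

open Classical in
/-- The self-similar measure `μ_{N,B}`: the unique measure with `IsSelfSimilarMeasure N B`, which
exists as soon as `2 ≤ N` and `B` is non-empty (and `0` otherwise). -/
noncomputable def selfSimilarMeasure (N : ℕ) (B : Finset ℤ) : Measure ℝ :=
  if h : ∃ μ : Measure ℝ, IsSelfSimilarMeasure N B μ then h.choose else 0

theorem isSelfSimilarMeasure_iff {N : ℕ} (hN : 2 ≤ N) {B : Finset ℤ} (hB : B.Nonempty)
    (μ : Measure ℝ) : IsSelfSimilarMeasure N B μ ↔ μ = selfSimilarMeasure N B := by
  have hex := exists_isSelfSimilarMeasure N hN B hB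
  have h : IsSelfSimilarMeasure N B (selfSimilarMeasure N B) := by
    rw [selfSimilarMeasure, dif_pos hex]
    exact hex.choose_spec
  exact ⟨fun hμ => hμ.unique hN h, fun hμ => hμ ▸ h⟩

/-! ### The canonical spectrum -/

/-- `m_B(x) = (#B)⁻¹ ∑_{b ∈ B} e^{2πi b x}`. -/
noncomputable def maskFun (B : Finset ℤ) (x : ℝ) : ℂ :=
  (B.card : ℂ)⁻¹ * ∑ b ∈ B, Complex.exp (2 * Real.pi * Complex.I * (b * x))

/-- `C = {x_0, …, x_k}` with `τ_{ℓ_j}(x_j) = x_{j+1}` for digits `ℓ_j ∈ L`, the indices being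
read modulo `k + 1` (addition in `Fin (k + 1)` is cyclic), and `|m_B| = 1` on `C`. -/
def IsExtremeCycle (N : ℕ) (B L : Finset ℤ) (C : Set ℝ) : Prop :=
  ∃ (k : ℕ) (x : Fin (k + 1) → ℝ) (l : Fin (k + 1) → ℤ),
    C = Set.range x ∧ (∀ j, l j ∈ L) ∧ (∀ j, ifsMap N (l j) (x j) = x (j + 1)) ∧
      ∀ j, ‖maskFun B (x j)‖ = 1

/-- The smallest set that contains `-C` for all extreme cycles `C` and is stable under
`s ↦ N s + ℓ` for `ℓ ∈ L`. -/
def canonicalSpectrum (N : ℕ) (B L : Finset ℤ) : Set ℝ :=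
  ⋂₀ {S : Set ℝ | (∀ C, IsExtremeCycle N B L C → ∀ x ∈ C, -x ∈ S) ∧
    ∀ s ∈ S, ∀ l ∈ L, (N : ℝ) * s + (l : ℝ) ∈ S}

/-! ### Spectral pairs -/

/-- `(μ, Λ)` is a spectral pair: `μ` is a Borel probability measure, `Λ` is countable, and the
exponentials `e^{2πi λ x}`, `λ ∈ Λ`, form an orthonormal (Hilbert) basis of `L²(μ)`. -/
def IsSpectralPair (μ : Measure ℝ) (Λ : Set ℝ) : Prop :=
  IsProbabilityMeasure μ ∧ Λ.Countable ∧
    ∃ e : HilbertBasis Λ ℂ (Lp ℂ 2 μ), ∀ l : Λ,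
      (e l : ℝ → ℂ) =ᵐ[μ] fun x => Complex.exp (2 * Real.pi * Complex.I * ((l : ℝ) * x))

/-- `t` is a spectral eigenvalue of the spectral pair `(μ, Λ)`: both `(μ, Λ)` and `(μ, tΛ)` are
spectral pairs. -/
def IsSpectralEigenvalue (μ : Measure ℝ) (Λ : Set ℝ) (t : ℝ) : Prop :=
  IsSpectralPair μ Λ ∧ IsSpectralPair μ ((fun l => t * l) '' Λ)

/-- `μ` has no atoms and is singular with respect to Lebesgue measure. -/
def IsSingularContinuous (μ : Measure ℝ) : Prop :=
  (∀ x : ℝ, μ {x} = 0) ∧ μ ⟂ₘ (volume : Measure ℝ)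

/-! ### The two conjectures -/

/-- Artin's primitive root conjecture: every integer `a ≥ 2` that is not a perfect square is a
primitive root modulo infinitely many primes. -/
def ArtinPrimitiveRootConjecture : Prop :=
  ∀ a : ℕ, 2 ≤ a → ¬ IsSquare a →
    {p : ℕ | p.Prime ∧ ¬ p ∣ a ∧ orderOf (a : ZMod p) = p - 1}.Infinite

/-- `π(y; q, a)`, the number of primes `p ≤ y` with `p ≡ a (mod q)`. -/
noncomputable def primeCountingAP (y : ℝ) (q : ℕ) (a : ℤ) : ℕ :=
  {p : ℕ | p.Prime ∧ (p : ℝ) ≤ y ∧ (p : ℤ) ≡ a [ZMOD q]}.ncard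

/-- `max_{y ≤ x} max_{gcd(a, q) = 1} |π(y; q, a) - π(y) / φ(q)|`; the set is non-empty, and for
`q ≥ 1` it has only finitely many elements. -/
noncomputable def apError (x : ℝ) (q : ℕ) : ℝ :=
  sSup {r : ℝ | ∃ (y : ℝ) (a : ℤ), y ≤ x ∧ IsCoprime a (q : ℤ) ∧
    r = |(primeCountingAP y q a : ℝ) - (Nat.primeCounting ⌊y⌋₊ : ℝ) / (Nat.totient q : ℝ)|}

/-- The Elliott–Halberstam conjecture. -/
def ElliottHalberstamConjecture : Prop :=
  ∀ θ : ℝ, 0 < θ → θ < 1 → ∀ A : ℝ, 0 < A → ∃ C : ℝ, 0 < C ∧ ∀ x : ℝ, 2 < x →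
    ∑ q ∈ Finset.Icc 1 ⌊x ^ θ⌋₊, apError x q ≤ C * x / (Real.log x) ^ A

/-! The dichotomy for `μ_{N,B}` is a matter of counting: the heaviest atoms would form a finite set
expanded by `x ↦ N x - b`, the attractor is Lebesgue null when `#B < N`, and when `#B = N` the
digits are distinct modulo `N`, which bounds `μ_{N,B}` by a multiple of Lebesgue measure.

By the criterion of Jorgensen and Pedersen, orthogonal exponentials `e^{2πisx}`, `s ∈ Λ`, form a
basis of `L²(μ)` as soon as `Q(t) = ∑_{s ∈ Λ} |μ̂(t + s)|²` is `1` everywhere. For the canonical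
spectrum `Q` is a fixed point of the transfer operator with weights `|m_B|²`, and its minimum is
attained on an extreme cycle, where `Q = 1`.

For a large prime `p`, `(N, B, pL)` is again a Hadamard triple, and its canonical spectrum is `pΛ`
unless it has an extreme cycle not contained in `p` times the dual of `B`. Such a cycle contains a
full orbit of multiplication by `N` modulo `p`; but for every `n` its points, which are of size
`O(p)`, lie within `O(p / N^n)` of the `(#B)^n` images of `0` under the `n`-fold compositions of the
maps `τ_ℓ`, `ℓ ∈ pL`. Taking `N^n ≈ p` shows that the order of `N` modulo `p` is
`O(p^{log_N #B})`. As `log_N #B < 1`, it remains to find infinitely many primes `p` for which this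
order is at least `p^θ`, with `θ < 1` arbitrary. Artin's conjecture for `a`, where `N = a^{2^j}`,
gives orders at least `(p - 1) / 2^j`. The Elliott–Halberstam conjecture gives many primes `p` such
that `p - 1` has a prime factor larger than `p^θ`; few of them have a smaller order of `N`. -/

open Filter Topology
open scoped FourierTransform ComplexConjugate ENNReal

/-! ### Masks -/

theorem fourierChar_eq_one_iff {x : ℝ} : 𝐞 x = 1 ↔ ∃ n : ℤ, x = n := by
  rw [Real.fourierChar_apply', Circle.exp_eq_one]
  refine exists_congr fun n => ?_
  rw [mul_comm (n : ℝ), mul_right_inj' Real.two_pi_pos.ne']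

theorem eq_of_sum_eq_card_nsmul {ι V : Type*} [NormedAddCommGroup V] [InnerProductSpace ℝ V]
    {s : Finset ι} {v : ι → V} {u : V} (hv : ∀ i ∈ s, ‖v i‖ = ‖u‖)
    (hsum : ∑ i ∈ s, v i = s.card • u) : ∀ i ∈ s, v i = u := by
  have hle : ∀ i ∈ s, inner ℝ (v i) u ≤ ‖u‖ ^ 2 := fun i hi =>
    (real_inner_le_norm _ _).trans_eq (by rw [hv i hi, sq])
  have heq : ∑ i ∈ s, inner ℝ (v i) u = ∑ _i ∈ s, ‖u‖ ^ 2 := by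
    rw [← sum_inner, hsum, ← Nat.cast_smul_eq_nsmul ℝ, real_inner_smul_left,
      real_inner_self_eq_norm_sq, Finset.sum_const, nsmul_eq_mul]
  intro i hi
  have hinner : inner ℝ (v i) u = ‖u‖ ^ 2 := (Finset.sum_eq_sum_iff_of_le hle).1 heq i hi
  have hdist : ‖v i - u‖ ^ 2 = 0 := by
    rw [norm_sub_sq_real, hinner, hv i hi]
    ring
  exact sub_eq_zero.1 (norm_eq_zero.1 (sq_eq_zero_iff.1 hdist))

/-- The group of all `x` with `b x ∈ ℤ` for every `b ∈ B`: the common periods of the characters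
whose average is `m_B`. When `0 ∈ B` it is the set where `|m_B| = 1`. -/
def digitDual (B : Finset ℤ) : AddSubgroup ℝ where
  carrier := {x | ∀ b ∈ B, ∃ n : ℤ, (b : ℝ) * x = n}
  add_mem' {x y} hx hy b hb := by
    obtain ⟨m, hm⟩ := hx b hb
    obtain ⟨n, hn⟩ := hy b hb
    exact ⟨m + n, by rw [mul_add, hm, hn, Int.cast_add]⟩
  zero_mem' b _ := ⟨0, by simp⟩
  neg_mem' {x} hx b hb := by
    obtain ⟨m, hm⟩ := hx b hb
    exact ⟨-m, by rw [mul_neg, hm, Int.cast_neg]⟩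

section Mask

variable {B : Finset ℤ}

theorem intCast_mem_digitDual (k : ℤ) : (k : ℝ) ∈ digitDual B :=
  fun b _ => ⟨b * k, (Int.cast_mul b k).symm⟩

theorem maskFun_eq (B : Finset ℤ) (x : ℝ) :
    maskFun B x = (B.card : ℂ)⁻¹ * ∑ b ∈ B, (𝐞 (b * x) : ℂ) := by
  simp only [maskFun, Real.fourierChar_apply]
  push_cast
  simp only [mul_right_comm _ Complex.I]

theorem continuous_maskFun (B : Finset ℤ) : Continuous (maskFun B) := by
  unfold maskFun
  fun_prop

theorem maskFun_zero (hB : B.Nonempty) : maskFun B 0 = 1 := by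
  have hcard : (B.card : ℂ) ≠ 0 := by simpa using hB.ne_empty
  simp [maskFun_eq, hcard]

theorem maskFun_add_of_mem_digitDual {y : ℝ} (hy : y ∈ digitDual B) (x : ℝ) :
    maskFun B (x + y) = maskFun B x := by
  rw [maskFun_eq, maskFun_eq]
  congr 1
  refine Finset.sum_congr rfl fun b hb => ?_
  rw [mul_add, AddChar.map_add_eq_mul, fourierChar_eq_one_iff.2 (hy b hb), mul_one]

theorem norm_maskFun_eq_one_iff (h0 : (0 : ℤ) ∈ B) {x : ℝ} :
    ‖maskFun B x‖ = 1 ↔ x ∈ digitDual B := by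
  refine ⟨fun hx => ?_, fun hx => ?_⟩
  · have hcard : (B.card : ℂ) ≠ 0 := by simpa using Finset.ne_empty_of_mem h0
    have hall : ∀ b ∈ B, (𝐞 (b * x) : ℂ) = maskFun B x := by
      refine eq_of_sum_eq_card_nsmul (fun b _ => by rw [Circle.norm_coe, hx]) ?_
      rw [maskFun_eq, nsmul_eq_mul, mul_inv_cancel_left₀ hcard]
    have hone : maskFun B x = 1 := by simpa using (hall 0 h0).symm
    exact fun b hb => fourierChar_eq_one_iff.1 (Circle.ext ((hall b hb).trans hone))
  · rw [← zero_add x, maskFun_add_of_mem_digitDual hx, maskFun_zero ⟨0, h0⟩, norm_one]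

end Mask

/-! ### Hadamard triples -/

theorem sum_zpow_mul_eq_zero {ι K : Type*} [Field K] [CharZero K] {N p : ℕ} {ζ : K}
    (hζ : IsPrimitiveRoot ζ N) (hN : N ≠ 0) (hp : p.Coprime N) (s : Finset ι) (f : ι → ℤ)
    (h : ∑ i ∈ s, ζ ^ f i = 0) : ∑ i ∈ s, ζ ^ (p * f i : ℤ) = 0 := by
  have hreduce : ∀ η : K, η ^ N = 1 → ∀ k : ℤ, η ^ k = η ^ (k % N).toNat := by
    intro η hη k
    have hη0 : η ≠ 0 := by
      rintro rfl
      exact zero_ne_one ((zero_pow hN).symm.trans hη)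
    rw [← zpow_natCast, Int.toNat_of_nonneg (Int.emod_nonneg _ (by exact_mod_cast hN))]
    conv_lhs => rw [← Int.emod_add_mul_ediv k N, zpow_add₀ hη0, zpow_mul, zpow_natCast, hη,
      one_zpow, mul_one]
  let P : Polynomial ℤ := ∑ i ∈ s, Polynomial.X ^ (f i % N).toNat
  have haeval : ∀ η : K, η ^ N = 1 → Polynomial.aeval η P = ∑ i ∈ s, η ^ f i := by
    intro η hη
    simp only [P, map_sum, map_pow, Polynomial.aeval_X, hreduce η hη]
  obtain ⟨R, hR⟩ := minpoly.isIntegrallyClosed_dvd (hζ.isIntegral (Nat.pos_of_ne_zero hN))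
    ((haeval ζ hζ.pow_eq_one).trans h)
  have hζp : (ζ ^ p) ^ N = 1 := by rw [pow_right_comm, hζ.pow_eq_one, one_pow]
  -- `ζ` and `ζ ^ p` have the same minimal polynomial.
  calc ∑ i ∈ s, ζ ^ (p * f i : ℤ) = Polynomial.aeval (ζ ^ p) P := by
        simp only [haeval _ hζp, zpow_mul, zpow_natCast]
    _ = 0 := by rw [hR, map_mul, hζ.minpoly_eq_pow_coprime hp, minpoly.aeval, zero_mul]

theorem maskFun_natCast_mul_div_eq_zero {B : Finset ℤ} {N p : ℕ} (hN : N ≠ 0)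
    (hp : p.Coprime N) {k : ℤ} (h : maskFun B (k / N) = 0) : maskFun B (p * k / N) = 0 := by
  have hζ : IsPrimitiveRoot (𝐞 (1 / N) : ℂ) N := by
    convert Complex.isPrimitiveRoot_exp N hN using 1
    rw [Real.fourierChar_apply]
    push_cast
    ring_nf
  have hmask : ∀ j : ℤ, maskFun B (j / N) =
      (B.card : ℂ)⁻¹ * ∑ b ∈ B, (𝐞 (1 / N) : ℂ) ^ (b * j) := by
    intro j
    rw [maskFun_eq]
    congr 1
    refine Finset.sum_congr rfl fun b _ => ?_
    rw [← Circle.coe_zpow, ← AddChar.map_zsmul_eq_zpow, zsmul_eq_mul]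
    push_cast
    ring_nf
  have hcast : (p * k / N : ℝ) = ((p * k : ℤ) : ℝ) / N := by push_cast; rfl
  rw [hcast, hmask]
  rw [hmask] at h
  rcases mul_eq_zero.1 h with h | h
  · rw [h, zero_mul]
  · simp only [mul_left_comm _ (p : ℤ), sum_zpow_mul_eq_zero hζ hN hp B _ h, mul_zero]

theorem ofReal_sum_norm_sq {ι : Type*} [Fintype ι] (w : ι → ℂ) :
    ((∑ i, ‖w i‖ ^ 2 : ℝ) : ℂ) = w ⬝ᵥ star w := by
  simp [dotProduct, Complex.mul_conj']

theorem sum_norm_vecMul_sq {m n : Type*} [Fintype m] [Fintype n] [DecidableEq m]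
    {A : Matrix m n ℂ} (hA : A * A.conjTranspose = 1) (u : m → ℂ) :
    ∑ j, ‖(Matrix.vecMul u A) j‖ ^ 2 = ∑ i, ‖u i‖ ^ 2 := by
  apply Complex.ofReal_injective
  rw [ofReal_sum_norm_sq, ofReal_sum_norm_sq, Matrix.star_vecMul, Matrix.dotProduct_mulVec,
    Matrix.vecMul_vecMul, hA, Matrix.vecMul_one]

section HadamardTriple

variable {N : ℕ} {B L : Finset ℤ}

theorem hadamardMatrix_apply (b : B) (l : L) :
    hadamardMatrix N B L b l = (√B.card : ℂ)⁻¹ * 𝐞 (b * (l / N)) := by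
  rw [hadamardMatrix, Real.fourierChar_apply]
  push_cast
  ring_nf

theorem conjTranspose_mul_hadamardMatrix_apply (l l' : L) :
    ((hadamardMatrix N B L).conjTranspose * hadamardMatrix N B L) l l' =
      maskFun B ((l' - l) / N) := by
  have hcard : (√B.card : ℂ)⁻¹ * (√B.card : ℂ)⁻¹ = (B.card : ℂ)⁻¹ := by
    rw [← mul_inv, ← Complex.ofReal_mul, Real.mul_self_sqrt (Nat.cast_nonneg _),
      Complex.ofReal_natCast]
  rw [Matrix.mul_apply, maskFun_eq, ← Finset.sum_coe_sort B, Finset.mul_sum]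
  refine Finset.sum_congr rfl fun b _ => ?_
  rw [Matrix.conjTranspose_apply, hadamardMatrix_apply, hadamardMatrix_apply, star_mul',
    Circle.star_addChar, ← Complex.ofReal_inv, Complex.star_def, Complex.conj_ofReal,
    Complex.ofReal_inv, mul_mul_mul_comm, ← Circle.coe_mul, ← AddChar.map_add_eq_mul, hcard,
    sub_div, mul_sub, neg_add_eq_sub]

theorem hadamardMatrix_swap (hcard : B.card = L.card) :
    hadamardMatrix N L B = (hadamardMatrix N B L).transpose := by
  ext l b
  rw [Matrix.transpose_apply, hadamardMatrix, hadamardMatrix, hcard, mul_comm (((l : ℤ) : ℂ))]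

namespace IsHadamardTriple

theorem maskFun_eq_zero (h : IsHadamardTriple N B L) {l l' : ℤ} (hl : l ∈ L) (hl' : l' ∈ L)
    (hne : l ≠ l') : maskFun B ((l - l') / N) = 0 := by
  rw [← conjTranspose_mul_hadamardMatrix_apply ⟨l', hl'⟩ ⟨l, hl⟩, h.conjTranspose_mul,
    Matrix.one_apply_ne (by simpa using hne.symm)]

theorem of_maskFun_eq_zero (hN : 2 ≤ N) (hcard : B.card = L.card) (hB : 2 ≤ B.card)
    (h : ∀ l ∈ L, ∀ l' ∈ L, l ≠ l' → maskFun B ((l - l') / N) = 0) :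
    IsHadamardTriple N B L := by
  have hone : (hadamardMatrix N B L).conjTranspose * hadamardMatrix N B L = 1 := by
    ext l l'
    rw [conjTranspose_mul_hadamardMatrix_apply]
    rcases eq_or_ne l l' with rfl | hne
    · rw [sub_self, zero_div, maskFun_zero (Finset.card_pos.1 (by omega)), Matrix.one_apply_eq]
    · rw [Matrix.one_apply_ne hne, h l' l'.2 l l.2 fun e => hne (Subtype.ext e.symm)]
  exact ⟨hN, hcard, hB,
    (Matrix.mul_eq_one_comm_of_card_eq _ _ _ (by simpa using hcard.symm)).1 hone, hone⟩

theorem symm (h : IsHadamardTriple N B L) : IsHadamardTriple N L B := by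
  have hswap := hadamardMatrix_swap (N := N) h.card_eq
  have hconj : (hadamardMatrix N L B).conjTranspose =
      (hadamardMatrix N B L).conjTranspose.transpose := by
    rw [hswap]
    rfl
  refine ⟨h.two_le, h.card_eq.symm, h.card_eq ▸ h.two_le_card, ?_, ?_⟩
  · rw [hconj, hswap, ← Matrix.transpose_mul, h.conjTranspose_mul, Matrix.transpose_one]
  · rw [hconj, hswap, ← Matrix.transpose_mul, h.mul_conjTranspose, Matrix.transpose_one]

theorem natCast_pos (h : IsHadamardTriple N B L) : (0 : ℝ) < N :=
  Nat.cast_pos.2 (two_pos.trans_le h.two_le)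

theorem nonempty_left (h : IsHadamardTriple N B L) : B.Nonempty :=
  Finset.card_pos.1 (two_pos.trans_le h.two_le_card)

theorem eq_of_dvd_sub (h : IsHadamardTriple N B L) {l l' : ℤ} (hl : l ∈ L) (hl' : l' ∈ L)
    (hd : (N : ℤ) ∣ l - l') : l = l' := by
  by_contra hne
  obtain ⟨k, hk⟩ := hd
  have hint : ((l - l') / N : ℝ) = 0 + k := by
    rw [zero_add, div_eq_iff h.natCast_pos.ne', mul_comm]
    exact_mod_cast hk
  have hone : maskFun B ((l - l') / N) = 1 := by
    rw [hint, maskFun_add_of_mem_digitDual (intCast_mem_digitDual k),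
      maskFun_zero h.nonempty_left]
  exact one_ne_zero (hone.symm.trans (h.maskFun_eq_zero hl hl' hne))

theorem image_mul (h : IsHadamardTriple N B L) {p : ℕ} (hp : p.Coprime N) (hp0 : p ≠ 0) :
    IsHadamardTriple N B (L.image fun l => (p : ℤ) * l) := by
  have hinj : Function.Injective fun l : ℤ => (p : ℤ) * l :=
    mul_right_injective₀ (by exact_mod_cast hp0)
  refine of_maskFun_eq_zero h.two_le
    (h.card_eq.trans (Finset.card_image_of_injective _ hinj).symm) h.two_le_card ?_
  simp only [Finset.mem_image]
  rintro _ ⟨l, hl, rfl⟩ _ ⟨l', hl', rfl⟩ hne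
  have hzero := maskFun_natCast_mul_div_eq_zero (k := l - l')
    (two_pos.trans_le h.two_le).ne' hp
    (by simpa using h.maskFun_eq_zero hl hl' fun e => hne (by rw [e]))
  simpa [mul_sub] using hzero

theorem sum_norm_maskFun_sq (h : IsHadamardTriple N B L) (t : ℝ) :
    ∑ l ∈ L, ‖maskFun B (ifsMap N l t)‖ ^ 2 = 1 := by
  have hcard : (√B.card : ℂ) * √B.card = B.card := by
    rw [← Complex.ofReal_mul, Real.mul_self_sqrt (Nat.cast_nonneg _), Complex.ofReal_natCast]
  let u : B → ℂ := fun b => (√B.card : ℂ)⁻¹ * 𝐞 (b * (t / N))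
  have hu : ∑ b, ‖u b‖ ^ 2 = 1 := by
    have hnorm : ∀ b, ‖u b‖ ^ 2 = (B.card : ℝ)⁻¹ := fun b => by
      rw [norm_mul, Circle.norm_coe, mul_one, norm_inv, Complex.norm_real, inv_pow,
        Real.norm_eq_abs, sq_abs, Real.sq_sqrt (Nat.cast_nonneg _)]
    simp [hnorm, h.nonempty_left.ne_empty]
  rw [← hu, ← sum_norm_vecMul_sq h.mul_conjTranspose, ← Finset.sum_coe_sort]
  refine Finset.sum_congr rfl fun l _ => ?_
  congr 2
  rw [Matrix.vecMul, dotProduct, maskFun_eq, ← Finset.sum_coe_sort B, Finset.mul_sum]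
  refine Finset.sum_congr rfl fun b _ => ?_
  rw [hadamardMatrix_apply, mul_mul_mul_comm, ← Circle.coe_mul, ← AddChar.map_add_eq_mul,
    ← mul_inv, hcard, ← mul_add, ifsMap, add_div]

end IsHadamardTriple

end HadamardTriple

/-! ### Continuity and singularity of the self-similar measure -/

section Atoms

variable {α : Type*} [MeasurableSpace α] [MeasurableSingletonClass α] (μ : Measure α)
  [IsFiniteMeasure μ]

theorem finite_setOf_le_measure_singleton {ε : ℝ≥0∞} (hε : ε ≠ 0) :
    {x | ε ≤ μ {x}}.Finite :=
  Measure.finite_const_le_meas_of_disjoint_iUnion μ (pos_iff_ne_zero.2 hε)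
    (fun x => measurableSet_singleton x) (fun _ _ hxy => Set.disjoint_singleton.2 hxy)
    (measure_ne_top _ _)

theorem exists_forall_measure_singleton_le {x₀ : α} (hx₀ : μ {x₀} ≠ 0) :
    ∃ x₁, ∀ x, μ {x} ≤ μ {x₁} := by
  obtain ⟨x₁, hx₁, hmax⟩ := Set.exists_max_image _ (fun x => μ {x})
    (finite_setOf_le_measure_singleton μ hx₀) ⟨x₀, le_refl (μ {x₀})⟩
  exact ⟨x₁, fun x => (le_total (μ {x₀}) (μ {x})).elim (hmax x) fun hx => hx.trans hx₁⟩

end Atoms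

theorem le_of_finite_of_mul_sub_mem {A : Set ℝ} (hA : A.Finite) (hne : A.Nonempty) {r b b' : ℝ}
    (hr : 1 ≤ r) (hb : ∀ x ∈ A, r * x - b ∈ A) (hb' : ∀ x ∈ A, r * x - b' ∈ A) : b' ≤ b := by
  obtain ⟨x, hx, hmax⟩ := Set.exists_max_image A id hA hne
  obtain ⟨y, hy, hmin⟩ := Set.exists_min_image A id hA hne
  have hxb : r * x - b ≤ x := hmax _ (hb x hx)
  have hyb : y ≤ r * y - b' := hmin _ (hb' y hy)
  nlinarith [show y ≤ x from hmin x hx]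

theorem mutuallySingular_of_forall_exists {α : Type*} [MeasurableSpace α] {μ ν : Measure α}
    (h : ∀ ε : ℝ≥0∞, 0 < ε → ∃ T : Set α, ν T + μ Tᶜ ≤ ε) : μ ⟂ₘ ν := by
  refine Measure.mutuallySingular_of_disjoint fun ρ hρμ hρν => ?_
  suffices hρ : ρ Set.univ ≤ 0 by
    rw [Measure.measure_univ_eq_zero.1 (le_antisymm hρ zero_le)]
    exact bot_le
  refine le_of_forall_gt_imp_ge_of_dense fun ε hε => ?_
  obtain ⟨T, hT⟩ := h ε hε
  calc ρ Set.univ ≤ ρ T + ρ Tᶜ := by rw [← Set.union_compl_self T]; exact measure_union_le _ _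
    _ ≤ ν T + μ Tᶜ := add_le_add (hρν T) (hρμ Tᶜ)
    _ ≤ ε := hT

theorem absolutelyContinuous_volume_of_closedBall_le {μ : Measure ℝ} {C : ℝ≥0∞} (hC : C ≠ ∞)
    {r : ℝ} (hr : 0 < r)
    (h : ∀ x δ, 0 < δ → δ ≤ r → μ (Metric.closedBall x δ) ≤ C * ENNReal.ofReal δ) :
    μ ≪ volume := by
  have hle : C⁻¹ • μ ≤ volume := by
    rw [← hausdorffMeasure_real]
    refine Measure.le_hausdorffMeasure 1 _ (ENNReal.ofReal (r / 2)) (by simpa using hr)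
      fun s hs => ?_
    rw [ENNReal.rpow_one, Measure.smul_apply, smul_eq_mul, mul_comm, ← div_eq_mul_inv]
    rcases s.eq_empty_or_nonempty with rfl | ⟨x, hx⟩
    · simp
    have hdiam : Metric.diam s ≤ r / 2 := ENNReal.toReal_le_of_le_ofReal (by positivity) hs
    have hbdd : Bornology.IsBounded s :=
      Metric.isBounded_iff_ediam_ne_top.2 (ne_top_of_le_ne_top ENNReal.ofReal_ne_top hs)
    have hbound : ∀ᶠ δ in 𝓝[>] (Metric.diam s), μ s ≤ C * ENNReal.ofReal δ := by
      filter_upwards [Ioc_mem_nhdsGT (hdiam.trans_lt (half_lt_self hr))] with δ hδ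
      refine (measure_mono fun y hy => ?_).trans (h x δ (Metric.diam_nonneg.trans_lt hδ.1) hδ.2)
      exact (Metric.dist_le_diam_of_mem hbdd hy hx).trans hδ.1.le
    have hlim : Tendsto (fun δ => C * ENNReal.ofReal δ) (𝓝[>] (Metric.diam s))
        (𝓝 (C * ENNReal.ofReal (Metric.diam s))) :=
      (ENNReal.Tendsto.const_mul ENNReal.continuous_ofReal.continuousAt (Or.inr hC)).mono_left
        nhdsWithin_le_nhds
    refine ENNReal.div_le_of_le_mul' ((ge_of_tendsto hlim hbound).trans_eq ?_)
    rw [Metric.diam, ENNReal.ofReal_toReal (Metric.isBounded_iff_ediam_ne_top.1 hbdd)]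
  exact (Measure.absolutelyContinuous_smul (ENNReal.inv_ne_zero.2 hC)).trans
    hle.absolutelyContinuous

/-- Hutchinson's operator `S ↦ ⋃_{b ∈ B} τ_b(S)`, whose fixed compact set is the attractor. -/
def hutchinson (N : ℕ) (B : Finset ℤ) (S : Set ℝ) : Set ℝ :=
  ⋃ b ∈ B, ifsMap N b '' S

section SelfSimilar

variable {N : ℕ} {B : Finset ℤ} {μ : Measure ℝ}

theorem continuous_ifsMap (N : ℕ) (c : ℤ) : Continuous (ifsMap N c) := by
  unfold ifsMap
  fun_prop

theorem isCompact_hutchinson {S : Set ℝ} (hS : IsCompact S) : IsCompact (hutchinson N B S) :=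
  B.isCompact_biUnion fun b _ => hS.image (continuous_ifsMap N b)

open scoped Pointwise in
theorem volume_ifsMap_image (hN : N ≠ 0) (c : ℤ) (S : Set ℝ) :
    volume (ifsMap N c '' S) = (N : ℝ≥0∞)⁻¹ * volume S := by
  have himage : ifsMap N c '' S = (N : ℝ)⁻¹ • ((· + (c : ℝ)) '' S) := by
    rw [← Set.image_smul, Set.image_image]
    exact Set.image_congr fun x _ => div_eq_inv_mul _ _
  rw [himage, Measure.addHaar_smul, Set.image_add_right, measure_preimage_add_right]
  simp [ENNReal.ofReal_inv_of_pos (Nat.cast_pos.2 (Nat.pos_of_ne_zero hN) : (0 : ℝ) < N)]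

theorem volume_hutchinson_le (hN : N ≠ 0) (B : Finset ℤ) (S : Set ℝ) :
    volume (hutchinson N B S) ≤ B.card / N * volume S := by
  refine (measure_biUnion_finset_le _ _).trans_eq ?_
  simp only [volume_ifsMap_image hN, Finset.sum_const, nsmul_eq_mul, div_eq_mul_inv, mul_assoc]

theorem ifsMap_preimage_singleton (hN : N ≠ 0) (c : ℤ) (x : ℝ) :
    ifsMap N c ⁻¹' {x} = {N * x - c} := by
  have hN0 : (N : ℝ) ≠ 0 := Nat.cast_ne_zero.2 hN
  ext y
  simp only [ifsMap, Set.mem_preimage, Set.mem_singleton_iff, div_eq_iff hN0, eq_sub_iff_add_eq,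
    mul_comm x]

theorem ifsMap_preimage_Ioc (hN : N ≠ 0) (c : ℤ) (x y : ℝ) :
    ifsMap N c ⁻¹' Set.Ioc x y = Set.Ioc (N * x - c) (N * y - c) := by
  have hN0 : (0 : ℝ) < N := Nat.cast_pos.2 (Nat.pos_of_ne_zero hN)
  ext z
  simp only [ifsMap, Set.mem_preimage, Set.mem_Ioc, lt_div_iff₀ hN0, div_le_iff₀ hN0,
    sub_lt_iff_lt_add, le_sub_iff_add_le, mul_comm (N : ℝ)]

namespace IsSelfSimilarMeasure

theorem measure_apply (h : IsSelfSimilarMeasure N B μ) {S : Set ℝ} (hS : MeasurableSet S) :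
    μ S = (B.card : ℝ≥0∞)⁻¹ * ∑ b ∈ B, μ (ifsMap N b ⁻¹' S) := by
  conv_lhs => rw [h.2]
  simp only [Measure.smul_apply, Measure.finsetSum_apply, smul_eq_mul,
    Measure.map_apply (measurable_ifsMap N _) hS]

theorem card_ne_zero (h : IsSelfSimilarMeasure N B μ) : (B.card : ℝ≥0∞) ≠ 0 := by
  rintro hB
  have hB' : B = ∅ := by simpa using hB
  have := h.1
  exact IsProbabilityMeasure.ne_zero μ (by rw [h.2, hB']; simp)

theorem card_mul_measure_apply (h : IsSelfSimilarMeasure N B μ) {S : Set ℝ}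
    (hS : MeasurableSet S) : B.card * μ S = ∑ b ∈ B, μ (ifsMap N b ⁻¹' S) := by
  rw [h.measure_apply hS, ENNReal.mul_inv_cancel_left h.card_ne_zero (ENNReal.natCast_ne_top _)]

/-- The heaviest atoms would form a finite set stable under `x ↦ N x - b` for all `b ∈ B`. -/
theorem measure_singleton (hN : N ≠ 0) (hB : B.Nontrivial) (h : IsSelfSimilarMeasure N B μ)
    (x₀ : ℝ) : μ {x₀} = 0 := by
  have := h.1
  by_contra hx₀
  obtain ⟨x₁, hx₁⟩ := exists_forall_measure_singleton_le μ hx₀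
  let A : Set ℝ := {x | μ {x₁} ≤ μ {x}}
  have hA : A.Finite := finite_setOf_le_measure_singleton μ fun h0 =>
    hx₀ (le_antisymm (h0 ▸ hx₁ x₀) zero_le)
  have hstable : ∀ b ∈ B, ∀ x ∈ A, (N : ℝ) * x - b ∈ A := by
    intro b hb x hx
    have hsum : ∑ b ∈ B, μ.real {(N : ℝ) * x - b} = ∑ _b ∈ B, μ.real {x₁} := by
      have hx' := h.card_mul_measure_apply (measurableSet_singleton x)
      simp only [ifsMap_preimage_singleton hN] at hx'
      rw [Finset.sum_const, nsmul_eq_mul, ← ENNReal.toReal_natCast B.card, measureReal_def,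
        le_antisymm hx (hx₁ x), ← ENNReal.toReal_mul, hx',
        ENNReal.toReal_sum fun _ _ => measure_ne_top _ _]
      rfl
    have heq := (Finset.sum_eq_sum_iff_of_le fun b _ =>
      ENNReal.toReal_mono (measure_ne_top _ _) (hx₁ _)).1 hsum b hb
    exact ((ENNReal.toReal_eq_toReal_iff' (measure_ne_top _ _) (measure_ne_top _ _)).1 heq).ge
  have hle : ∀ b ∈ B, ∀ b' ∈ B, b' ≤ b := fun b hb b' hb' => by
    exact_mod_cast le_of_finite_of_mul_sub_mem hA ⟨x₁, le_refl (μ {x₁})⟩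
      (Nat.one_le_cast.2 (Nat.one_le_iff_ne_zero.2 hN)) (hstable b hb) (hstable b' hb')
  obtain ⟨b, hb, b', hb', hne⟩ := hB
  exact hne (le_antisymm (hle b' hb' b hb) (hle b hb b' hb'))

theorem measure_compl_hutchinson_le (h : IsSelfSimilarMeasure N B μ) {S : Set ℝ}
    (hS : MeasurableSet (hutchinson N B S)) : μ (hutchinson N B S)ᶜ ≤ μ Sᶜ := by
  have hsub : ∀ b ∈ B, ifsMap N b ⁻¹' (hutchinson N B S)ᶜ ⊆ Sᶜ := fun b hb x hx hxS =>
    hx (Set.mem_biUnion hb ⟨x, hxS, rfl⟩)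
  calc μ (hutchinson N B S)ᶜ
      = (B.card : ℝ≥0∞)⁻¹ * ∑ b ∈ B, μ (ifsMap N b ⁻¹' (hutchinson N B S)ᶜ) :=
        h.measure_apply hS.compl
    _ ≤ (B.card : ℝ≥0∞)⁻¹ * ∑ _b ∈ B, μ Sᶜ := by
        gcongr with b hb
        exact hsub b hb
    _ = μ Sᶜ := by
        rw [Finset.sum_const, nsmul_eq_mul, ← mul_assoc,
          ENNReal.inv_mul_cancel h.card_ne_zero (ENNReal.natCast_ne_top _), one_mul]

theorem mutuallySingular_volume (hcard : B.card < N) (h : IsSelfSimilarMeasure N B μ) :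
    μ ⟂ₘ (volume : Measure ℝ) := by
  have := h.1
  refine mutuallySingular_of_forall_exists fun ε hε => ?_
  obtain ⟨K, hK, hμK⟩ := isTightMeasureSet_iff_exists_isCompact_measure_compl_le.1
    (isTightMeasureSet_singleton (μ := μ)) (ε / 2) (ENNReal.half_pos hε.ne')
  have hcompact : ∀ n, IsCompact ((hutchinson N B)^[n] K) := fun n =>
    Function.Iterate.rec IsCompact hK (fun _ => isCompact_hutchinson) n
  have hμ : ∀ n, μ ((hutchinson N B)^[n] K)ᶜ ≤ ε / 2 := by
    intro n
    induction n with
    | zero => exact hμK μ rfl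
    | succ n ih =>
      have hc := hcompact (n + 1)
      rw [Function.iterate_succ_apply'] at hc ⊢
      exact (h.measure_compl_hutchinson_le hc.measurableSet).trans ih
  have hvol : ∀ n, volume ((hutchinson N B)^[n] K) ≤ (B.card / N : ℝ≥0∞) ^ n * volume K := by
    intro n
    induction n with
    | zero => simp
    | succ n ih =>
      rw [Function.iterate_succ_apply', pow_succ', mul_assoc]
      exact (volume_hutchinson_le (Nat.ne_zero_of_lt hcard) B _).trans (by gcongr)
  have hratio : (B.card / N : ℝ≥0∞) < 1 :=
    ENNReal.div_lt_of_lt_mul (by rw [one_mul]; exact_mod_cast hcard)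
  have hlim : Tendsto (fun n => (B.card / N : ℝ≥0∞) ^ n * volume K) atTop (𝓝 0) := by
    simpa using ENNReal.Tendsto.mul_const (ENNReal.tendsto_pow_atTop_nhds_zero_of_lt_one hratio)
      (Or.inr hK.measure_lt_top.ne)
  obtain ⟨n, hn⟩ := (hlim.eventually_le_const (ENNReal.half_pos hε.ne')).exists
  refine ⟨(hutchinson N B)^[n] K, ?_⟩
  rw [← ENNReal.add_halves ε]
  exact add_le_add ((hvol n).trans hn) (hμ n)

/-- The induction runs on the sum over all integer translates, because digits that are distinct
modulo `N` make `(k, b) ↦ N k - b` injective. -/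
theorem tsum_measure_Ioc_le (hN : N ≠ 0)
    (hinj : ∀ b ∈ B, ∀ b' ∈ B, (N : ℤ) ∣ b - b' → b = b') (h : IsSelfSimilarMeasure N B μ)
    (n : ℕ) (a : ℝ) :
    ∑' k : ℤ, μ (Set.Ioc (a + k) (a + k + ((N : ℝ) ^ n)⁻¹)) ≤ ((B.card : ℝ≥0∞)⁻¹) ^ n := by
  have := h.1
  induction n generalizing a with
  | zero =>
    simp only [pow_zero, inv_one]
    rw [← measure_iUnion (Set.pairwise_disjoint_Ioc_add_intCast a) fun _ => measurableSet_Ioc]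
    exact prob_le_one
  | succ n ih =>
    let g : ℤ → ℝ≥0∞ := fun j => μ (Set.Ioc (N * a + j) (N * a + j + ((N : ℝ) ^ n)⁻¹))
    have hstep : ∀ k : ℤ, μ (Set.Ioc (a + k) (a + k + ((N : ℝ) ^ (n + 1))⁻¹))
        = (B.card : ℝ≥0∞)⁻¹ * ∑' b : B, g (N * k - b) := by
      intro k
      rw [h.measure_apply measurableSet_Ioc, tsum_fintype,
        Finset.sum_coe_sort B fun b => g (N * k - b)]
      refine congrArg _ (Finset.sum_congr rfl fun b _ => ?_)
      rw [ifsMap_preimage_Ioc hN]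
      simp only [g]
      push_cast
      congr 2
      · ring
      · rw [pow_succ]
        field_simp
        ring
    have hdigits : Function.Injective fun z : ℤ × B => (N : ℤ) * z.1 - (z.2 : ℤ) := by
      rintro ⟨k, b, hb⟩ ⟨k', b', hb'⟩ he
      simp only at he
      obtain rfl : b = b' := hinj b hb b' hb' ⟨k - k', by linear_combination -he⟩
      rw [mul_right_injective₀ (Nat.cast_ne_zero.2 hN) (sub_left_injective he)]
    rw [tsum_congr hstep, ENNReal.tsum_mul_left, pow_succ',
      ← ENNReal.tsum_prod' (f := fun z : ℤ × B => g (N * z.1 - z.2))]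
    gcongr
    exact (ENNReal.tsum_comp_le_tsum_of_injective hdigits g).trans (ih (N * a))

theorem absolutelyContinuous_volume (hN : 2 ≤ N)
    (hinj : ∀ b ∈ B, ∀ b' ∈ B, (N : ℤ) ∣ b - b' → b = b') (hcard : N ≤ B.card)
    (h : IsSelfSimilarMeasure N B μ) : μ ≪ (volume : Measure ℝ) := by
  have hN0 : (0 : ℝ) < N := Nat.cast_pos.2 (by omega)
  have hIoc : ∀ (n : ℕ) (a : ℝ),
      μ (Set.Ioc a (a + ((N : ℝ) ^ n)⁻¹)) ≤ ENNReal.ofReal ((N : ℝ) ^ n)⁻¹ := by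
    intro n a
    calc μ (Set.Ioc a (a + ((N : ℝ) ^ n)⁻¹))
        ≤ ∑' k : ℤ, μ (Set.Ioc (a + k) (a + k + ((N : ℝ) ^ n)⁻¹)) := by
          simpa using ENNReal.le_tsum (f := fun k : ℤ =>
            μ (Set.Ioc (a + k) (a + k + ((N : ℝ) ^ n)⁻¹))) 0
      _ ≤ ((B.card : ℝ≥0∞)⁻¹) ^ n := h.tsum_measure_Ioc_le (by omega) hinj n a
      _ ≤ ENNReal.ofReal ((N : ℝ) ^ n)⁻¹ := by
          rw [ENNReal.ofReal_inv_of_pos (by positivity), ENNReal.ofReal_pow hN0.le,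
            ENNReal.ofReal_natCast, ENNReal.inv_pow]
          gcongr
  refine absolutelyContinuous_volume_of_closedBall_le (C := ENNReal.ofReal (4 * N))
    ENNReal.ofReal_ne_top (by norm_num : (0 : ℝ) < 1 / 4) fun x δ hδ hδ' => ?_
  obtain ⟨n, hn, hn'⟩ := exists_nat_pow_near_of_lt_one (by positivity : 0 < 4 * δ) (by linarith)
    (inv_pos.2 hN0) (inv_lt_one_of_one_lt₀ (by exact_mod_cast hN : (1 : ℝ) < N))
  rw [inv_pow] at hn hn'
  calc μ (Metric.closedBall x δ)
      ≤ μ (Set.Ioc (x - 2 * δ) (x - 2 * δ + ((N : ℝ) ^ n)⁻¹)) := by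
        refine measure_mono fun y hy => ?_
        rw [Real.closedBall_eq_Icc] at hy
        exact ⟨by linarith [hy.1], by linarith [hy.2]⟩
    _ ≤ ENNReal.ofReal ((N : ℝ) ^ n)⁻¹ := hIoc n _
    _ ≤ ENNReal.ofReal (4 * N * δ) := by
        refine ENNReal.ofReal_le_ofReal ?_
        rw [pow_succ, mul_inv, ← div_eq_mul_inv, div_lt_iff₀ hN0] at hn
        linarith
    _ = ENNReal.ofReal (4 * N) * ENNReal.ofReal δ := ENNReal.ofReal_mul (by positivity)

end IsSelfSimilarMeasure

end SelfSimilar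

theorem IsHadamardTriple.isSelfSimilarMeasure {N : ℕ} {B L : Finset ℤ}
    (h : IsHadamardTriple N B L) : IsSelfSimilarMeasure N B (selfSimilarMeasure N B) :=
  (isSelfSimilarMeasure_iff h.two_le h.nonempty_left _).2 rfl

theorem isSingularContinuous_selfSimilarMeasure_iff {N : ℕ} {B L : Finset ℤ}
    (h : IsHadamardTriple N B L) :
    IsSingularContinuous (selfSimilarMeasure N B) ↔ B.card < N := by
  have hμ := h.isSelfSimilarMeasure
  have := hμ.1
  refine ⟨fun hs => ?_, fun hlt => ⟨hμ.measure_singleton (Nat.ne_zero_of_lt h.two_le)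
    (Finset.one_lt_card_iff_nontrivial.1 h.two_le_card), hμ.mutuallySingular_volume hlt⟩⟩
  by_contra! hge
  have hac := hμ.absolutelyContinuous_volume h.two_le
    (fun b hb b' hb' => h.symm.eq_of_dvd_sub hb hb') hge
  exact IsProbabilityMeasure.ne_zero (selfSimilarMeasure N B)
    ((Measure.MutuallySingular.self_iff _).1 (hs.2.mono_ac .rfl hac))

/-! ### Extreme cycles and the transfer operator -/

theorem exists_isPeriodicPt_of_mapsTo {α : Type*} {U : Set α} (hU : U.Finite) (hne : U.Nonempty)
    {g : α → α} (hg : Set.MapsTo g U U) : ∃ y ∈ U, ∃ k, Function.IsPeriodicPt g (k + 1) y := by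
  obtain ⟨y, hy⟩ := hne
  obtain ⟨i, j, hij, heq⟩ :=
    hU.exists_lt_map_eq_of_forall_mem (f := fun n => g^[n] y) fun n => hg.iterate n hy
  obtain ⟨k, rfl⟩ := Nat.exists_eq_add_of_lt hij
  refine ⟨g^[i] y, hg.iterate i hy, k, ?_⟩
  rw [Function.IsPeriodicPt, Function.IsFixedPt, ← Function.iterate_add_apply, heq]
  congr 1
  omega

section ExtremeCycles

variable {N : ℕ} {B L : Finset ℤ}

@[simp]
theorem ifsMap_zero (N : ℕ) (x : ℝ) : ifsMap N 0 x = x / N := by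
  simp [ifsMap]

theorem isExtremeCycle_singleton_zero (hB : B.Nonempty) (hL : (0 : ℤ) ∈ L) :
    IsExtremeCycle N B L {0} :=
  ⟨0, fun _ => 0, fun _ => 0, by simp, fun _ => hL, fun _ => by simp,
    fun _ => by simp [maskFun_zero hB]⟩

theorem exists_isExtremeCycle_of_mapsTo {U : Set ℝ} (hU : U.Finite) (hne : U.Nonempty)
    (h : ∀ y ∈ U, ∃ l ∈ L, ifsMap N l y ∈ U ∧ ‖maskFun B (ifsMap N l y)‖ = 1) :
    ∃ C, IsExtremeCycle N B L C ∧ (C ∩ U).Nonempty := by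
  choose! d hdL hdU hd1 using h
  obtain ⟨y, hy, k, hper⟩ :=
    exists_isPeriodicPt_of_mapsTo hU hne (g := fun z => ifsMap N (d z) z) hdU
  let x : Fin (k + 1) → ℝ := fun j => (fun z => ifsMap N (d z) z)^[j] y
  have hxU : ∀ j, x j ∈ U := fun j => Set.MapsTo.iterate hdU j hy
  have hx : ∀ j, ifsMap N (d (x j)) (x j) = x (j + 1) := fun j => by
    simp only [x, Fin.val_add, Fin.val_one', Nat.add_mod_mod, hper.iterate_mod_apply,
      Function.iterate_succ_apply']
  refine ⟨Set.range x, ⟨k, x, fun j => d (x j), rfl, fun j => hdL _ (hxU j), hx, fun j => ?_⟩,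
    x 0, ⟨0, rfl⟩, hxU 0⟩
  rw [← sub_add_cancel j 1, ← hx]
  exact hd1 _ (hxU _)

namespace IsHadamardTriple

theorem exists_maskFun_ifsMap_ne_zero (h : IsHadamardTriple N B L) (y : ℝ) :
    ∃ l ∈ L, maskFun B (ifsMap N l y) ≠ 0 := by
  by_contra! hc
  have hsum := h.sum_norm_maskFun_sq y
  rw [Finset.sum_eq_zero fun l hl => by rw [hc l hl, norm_zero, sq, zero_mul]] at hsum
  exact zero_ne_one hsum

theorem injOn_fract_ifsMap (h : IsHadamardTriple N B L) {P : Finset ℝ}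
    (hP : Set.InjOn Int.fract (P : Set ℝ)) :
    Set.InjOn (fun z : ℝ × ℤ => Int.fract (ifsMap N z.2 z.1)) (P ×ˢ L : Finset (ℝ × ℤ)) := by
  rintro ⟨y, l⟩ hz ⟨y', l'⟩ hz' heq
  simp only [Finset.coe_product, Set.mem_prod, Finset.mem_coe] at hz hz'
  obtain ⟨j, hj⟩ := Int.fract_eq_fract.1 heq
  have hN := h.natCast_pos.ne'
  simp only [ifsMap] at hj
  field_simp at hj
  obtain rfl : y = y' := hP hz.1 hz'.1
    (Int.fract_eq_fract.2 ⟨N * j + l' - l, by push_cast; linarith⟩)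
  have hl : (l : ℝ) - l' = N * j := by linarith
  rw [h.eq_of_dvd_sub hz.2 hz'.2 ⟨j, by exact_mod_cast hl⟩]

open Classical in
/-- Since a maximal set of incongruent points (modulo `ℤ`) has at least as many points as it has
children `τ_ℓ(y)` with `m_B(τ_ℓ(y)) ≠ 0`, every point of it has only one child. -/
theorem exists_child_of_maximalFor (h : IsHadamardTriple N B L) {F : Set ℝ}
    (hF : ∀ z ∈ F, ∀ l ∈ L, maskFun B (ifsMap N l z) ≠ 0 → ifsMap N l z ∈ F) {P : Finset ℝ}
    (hP : MaximalFor (fun P : Finset ℝ => (P : Set ℝ) ⊆ F ∧ Set.InjOn Int.fract (P : Set ℝ))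
      Finset.card P) :
    ∃ P', MaximalFor (fun P : Finset ℝ => (P : Set ℝ) ⊆ F ∧ Set.InjOn Int.fract (P : Set ℝ))
      Finset.card P' ∧
      ∀ y ∈ P, ∃ l ∈ L, ifsMap N l y ∈ P' ∧ ‖maskFun B (ifsMap N l y)‖ = 1 := by
  let E : Finset (ℝ × ℤ) := (P ×ˢ L).filter fun z => maskFun B (ifsMap N z.2 z.1) ≠ 0
  have hE : ∀ z, z ∈ E ↔ (z.1 ∈ P ∧ z.2 ∈ L) ∧ maskFun B (ifsMap N z.2 z.1) ≠ 0 := fun z => by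
    rw [Finset.mem_filter, Finset.mem_product]
  have hinj : Set.InjOn (fun z : ℝ × ℤ => Int.fract (ifsMap N z.2 z.1)) E :=
    (h.injOn_fract_ifsMap hP.1.2).mono (Finset.coe_subset.2 (Finset.filter_subset _ _))
  let P' : Finset ℝ := E.image fun z => ifsMap N z.2 z.1
  have hP' : (P' : Set ℝ) ⊆ F ∧ Set.InjOn Int.fract (P' : Set ℝ) := by
    rw [Finset.coe_image]
    refine ⟨?_, hinj.image_of_comp⟩
    rintro _ ⟨z, hz, rfl⟩
    obtain ⟨⟨hzP, hzL⟩, hne⟩ := (hE z).1 hz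
    exact hF _ (hP.1.1 hzP) _ hzL hne
  have hcard : P'.card = E.card :=
    Finset.card_image_of_injOn (Set.InjOn.of_comp (g := Int.fract) hinj)
  have hsurj : Set.SurjOn Prod.fst (E : Set (ℝ × ℤ)) P := fun y hy => by
    obtain ⟨l, hl, hne⟩ := h.exists_maskFun_ifsMap_ne_zero y
    exact ⟨(y, l), (hE _).2 ⟨⟨hy, hl⟩, hne⟩, rfl⟩
  have hle : P.card ≤ P'.card := hcard ▸ Finset.card_le_card_of_surjOn _ hsurj
  have hge : P'.card ≤ P.card := hP.2 hP' hle
  have huniq : Set.InjOn Prod.fst (E : Set (ℝ × ℤ)) := Finset.injOn_of_surjOn_of_card_le _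
    (fun z hz => ((hE z).1 hz).1.1) hsurj (hcard ▸ hge)
  refine ⟨P', ⟨hP', fun Q hQ hPQ => (hP.2 hQ (hle.trans hPQ)).trans hle⟩, fun y hy => ?_⟩
  obtain ⟨l, hl, hne⟩ := h.exists_maskFun_ifsMap_ne_zero y
  have hyl : (y, l) ∈ E := (hE _).2 ⟨⟨hy, hl⟩, hne⟩
  refine ⟨l, hl, Finset.mem_image_of_mem _ hyl, ?_⟩
  have hsum := h.sum_norm_maskFun_sq y
  rw [Finset.sum_eq_single_of_mem l hl fun l' hl' hll' => ?_] at hsum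
  · exact (pow_eq_one_iff_of_nonneg (norm_nonneg _) two_ne_zero).1 hsum
  · by_contra hne'
    have hyl' : (y, l') ∈ E := (hE _).2 ⟨⟨hy, hl'⟩, fun h0 => hne' (by simp [h0])⟩
    exact hll' (congrArg Prod.snd (huniq hyl' hyl rfl))

theorem exists_isExtremeCycle_of_finite (h : IsHadamardTriple N B L) {F : Set ℝ} (hF : F.Finite)
    (hne : F.Nonempty)
    (hstep : ∀ z ∈ F, ∀ l ∈ L, maskFun B (ifsMap N l z) ≠ 0 → ifsMap N l z ∈ F) :
    ∃ C, IsExtremeCycle N B L C ∧ (C ∩ F).Nonempty := by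
  let p : Finset ℝ → Prop := fun P => (P : Set ℝ) ⊆ F ∧ Set.InjOn Int.fract (P : Set ℝ)
  have hp : {P | p P}.Finite := hF.toFinset.powerset.finite_toSet.subset fun P hP => by
    simpa [Set.Finite.subset_toFinset] using hP.1
  obtain ⟨z, hz⟩ := hne
  have hpz : p {z} := by simp [p, hz]
  obtain ⟨P, hP⟩ := hp.exists_maximalFor Finset.card _ ⟨{z}, hpz⟩
  obtain ⟨y, hy⟩ : P.Nonempty := by
    rw [← Finset.card_pos]
    by_contra! h0
    simpa using (hP.2 hpz (h0.trans zero_le)).trans h0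
  let U : Set ℝ := {x | ∃ P, MaximalFor p Finset.card P ∧ x ∈ P}
  have hUF : U ⊆ F := fun x ⟨P, hP, hx⟩ => hP.1.1 hx
  obtain ⟨C, hC, x, hxC, hxU⟩ := exists_isExtremeCycle_of_mapsTo (hF.subset hUF) ⟨y, P, hP, hy⟩
    fun x ⟨P, hP, hx⟩ => by
      obtain ⟨P', hP', hchild⟩ := h.exists_child_of_maximalFor hstep hP
      obtain ⟨l, hl, hlP', hl1⟩ := hchild x hx
      exact ⟨l, hl, ⟨P', hP', hlP'⟩, hl1⟩
  exact ⟨C, hC, x, hxC, hUF hxU⟩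

end IsHadamardTriple

theorem finite_inter_maskFun_eq_zero (hB : B.Nonempty) {K : Set ℝ} (hK : IsCompact K) :
    (K ∩ {x | maskFun B x = 0}).Finite := by
  by_contra hinf
  obtain ⟨x, -, hx⟩ := Set.Infinite.exists_accPt_of_subset_isCompact hinf hK Set.inter_subset_left
  have han : AnalyticOnNhd ℝ (maskFun B) Set.univ := by
    intro y _
    have hexp : ∀ b : ℤ, AnalyticAt ℝ
        (fun x : ℝ => Complex.exp (2 * Real.pi * Complex.I * (b * x))) y := fun b =>
      analyticAt_cexp.restrictScalars.comp
        (analyticAt_const.mul (analyticAt_const.mul (Complex.ofRealCLM.analyticAt y)))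
    exact analyticAt_const.mul (Finset.analyticAt_fun_sum B fun b _ => hexp b)
  have hzero := han.eqOn_zero_of_preconnected_of_frequently_eq_zero isPreconnected_univ
    (Set.mem_univ x) ((accPt_iff_frequently_nhdsNE.1 hx).mono fun y hy => hy.2) (Set.mem_univ 0)
  exact one_ne_zero ((maskFun_zero hB).symm.trans hzero)

theorem eventually_forall_maskFun_div_pow_ne_zero (hN : 1 < N) (hB : B.Nonempty) (K : ℝ) :
    ∀ᶠ k : ℕ in atTop, ∀ z ∈ Set.Icc (-K) K, maskFun B (z / (N : ℝ) ^ k) ≠ 0 := by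
  have hne : ∀ᶠ x in 𝓝 (0 : ℝ), maskFun B x ≠ 0 :=
    (continuous_maskFun B).continuousAt.eventually_ne (by rw [maskFun_zero hB]; exact one_ne_zero)
  obtain ⟨δ, hδ, hball⟩ := Metric.eventually_nhds_iff.1 hne
  have hlim : Tendsto (fun n : ℕ => K / (N : ℝ) ^ n) atTop (𝓝 0) :=
    (tendsto_pow_atTop_atTop_of_one_lt (by exact_mod_cast hN)).const_div_atTop K
  filter_upwards [hlim.eventually (gt_mem_nhds hδ)] with k hk z hz
  refine hball (lt_of_le_of_lt ?_ hk)
  rw [Real.dist_eq, sub_zero, abs_div, abs_of_nonneg (by positivity : (0 : ℝ) ≤ N ^ k)]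
  gcongr
  exact abs_le.2 hz

theorem finite_setOf_exists_maskFun_div_pow_eq_zero (hN : 1 < N) (hB : B.Nonempty) (K : ℝ) :
    {z | z ∈ Set.Icc (-K) K ∧ ∃ k : ℕ, maskFun B (z / (N : ℝ) ^ k) = 0}.Finite := by
  obtain ⟨k₀, hk₀⟩ := eventually_atTop.1 (eventually_forall_maskFun_div_pow_ne_zero hN hB K)
  have hfin : (⋃ k ∈ Finset.range k₀, (fun z : ℝ => z / (N : ℝ) ^ k) ⁻¹'
      (Set.Icc (-K) K ∩ {x | maskFun B x = 0})).Finite :=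
    Set.Finite.biUnion (Finset.finite_toSet _) fun k _ =>
      (finite_inter_maskFun_eq_zero hB isCompact_Icc).preimage
        fun a _ b _ hab => (div_left_inj' (by positivity)).1 hab
  refine hfin.subset fun z ⟨hz, k, hk⟩ => Set.mem_biUnion (x := k) ?_ ⟨?_, hk⟩
  · by_contra hc
    exact hk₀ k (by simpa using hc) z hz hk
  · rw [Set.mem_Icc, ← abs_le, abs_div, abs_of_nonneg (by positivity : (0 : ℝ) ≤ N ^ k)]
    exact (div_le_self (abs_nonneg _) (one_le_pow₀ (by exact_mod_cast hN.le))).trans (abs_le.2 hz)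

theorem exists_forall_mapsTo_ifsMap_Icc (hN : 2 ≤ N) (L : Finset ℤ) (t : ℝ) :
    ∃ K, t ∈ Set.Icc (-K) K ∧
      ∀ l ∈ L, Set.MapsTo (ifsMap N l) (Set.Icc (-K) K) (Set.Icc (-K) K) := by
  have hN2 : (2 : ℝ) ≤ N := by exact_mod_cast hN
  have hN0 : (0 : ℝ) < N := by linarith
  refine ⟨|t| + ∑ l ∈ L, |(l : ℝ)|,
    abs_le.1 (le_add_of_nonneg_right (Finset.sum_nonneg fun _ _ => abs_nonneg _)),
    fun l hl z hz => ?_⟩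
  have hl' := (Finset.single_le_sum (f := fun l : ℤ => |(l : ℝ)|)
    (fun _ _ => abs_nonneg _) hl).trans (le_add_of_nonneg_left (abs_nonneg t))
  have hl0 := (abs_nonneg _).trans hl'
  rw [abs_le] at hl'
  rw [ifsMap, Set.mem_Icc, le_div_iff₀ hN0, div_le_iff₀ hN0]
  constructor <;> nlinarith [hz.1, hz.2]

theorem apply_zero_eq_of_forall_maskFun_ne_zero (hN : 1 < N) {Q : ℝ → ℝ} (hQ : Continuous Q)
    {Z : Set ℝ} {m : ℝ} (hm : ∀ z ∈ Z, Q z = m)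
    (hstep : ∀ z ∈ Z, maskFun B (z / N) ≠ 0 → z / N ∈ Z) {z : ℝ} (hz : z ∈ Z)
    (hne : ∀ k : ℕ, maskFun B (z / (N : ℝ) ^ k) ≠ 0) : Q 0 = m := by
  have hmem : ∀ k : ℕ, z / (N : ℝ) ^ k ∈ Z := by
    intro k
    induction k with
    | zero => simpa using hz
    | succ k ih =>
      have hk := hne (k + 1)
      rw [pow_succ, ← div_div] at hk ⊢
      exact hstep _ ih hk
  have hlim : Tendsto (fun n : ℕ => z / (N : ℝ) ^ n) atTop (𝓝 0) :=
    (tendsto_pow_atTop_atTop_of_one_lt (by exact_mod_cast hN)).const_div_atTop z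
  exact tendsto_nhds_unique ((hQ.tendsto 0).comp hlim)
    (tendsto_const_nhds.congr fun k => (hm _ (hmem k)).symm)

namespace IsHadamardTriple

variable {Q : ℝ → ℝ}

theorem eq_min_of_maskFun_ne_zero (h : IsHadamardTriple N B L)
    (htr : ∀ t, Q t = ∑ l ∈ L, ‖maskFun B (ifsMap N l t)‖ ^ 2 * Q (ifsMap N l t)) {z : ℝ}
    (hz : ∀ l ∈ L, Q z ≤ Q (ifsMap N l z)) {l : ℤ} (hl : l ∈ L)
    (hne : maskFun B (ifsMap N l z) ≠ 0) : Q (ifsMap N l z) = Q z := by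
  have hsum : ∑ l ∈ L, ‖maskFun B (ifsMap N l z)‖ ^ 2 * (Q (ifsMap N l z) - Q z) = 0 := by
    simp_rw [mul_sub]
    rw [Finset.sum_sub_distrib, ← htr z, ← Finset.sum_mul, h.sum_norm_maskFun_sq, one_mul, sub_self]
  have hterm := (Finset.sum_eq_zero_iff_of_nonneg fun l hl =>
    mul_nonneg (sq_nonneg _) (sub_nonneg.2 (hz l hl))).1 hsum l hl
  exact sub_eq_zero.1
    ((mul_eq_zero.1 hterm).resolve_left (pow_ne_zero 2 (norm_ne_zero_iff.2 hne)))

/-- The points where `Q` attains a minimum below `1` form a set stable under the `τ_ℓ` with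
`m_B(τ_ℓ(z)) ≠ 0`; it is finite, as following `τ_0` from any of its points must meet a zero of `m_B`
(else `Q 0 < 1`), and hence meets a cycle. -/
theorem one_le_of_transfer_eq (h : IsHadamardTriple N B L) (hL : (0 : ℤ) ∈ L) (hQ : Continuous Q)
    (htr : ∀ t, Q t = ∑ l ∈ L, ‖maskFun B (ifsMap N l t)‖ ^ 2 * Q (ifsMap N l t))
    (hcyc : ∀ C, IsExtremeCycle N B L C → ∀ x ∈ C, 1 ≤ Q x) (t : ℝ) : 1 ≤ Q t := by
  by_contra! hlt
  obtain ⟨K, htK, hmaps⟩ := exists_forall_mapsTo_ifsMap_Icc h.two_le L t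
  obtain ⟨z₀, hz₀, hmin⟩ := isCompact_Icc.exists_isMinOn ⟨t, htK⟩ hQ.continuousOn
  have hQz₀ : Q z₀ < 1 := (hmin htK).trans_lt hlt
  let Z : Set ℝ := {z | z ∈ Set.Icc (-K) K ∧ Q z = Q z₀}
  have hstep : ∀ z ∈ Z, ∀ l ∈ L, maskFun B (ifsMap N l z) ≠ 0 → ifsMap N l z ∈ Z :=
    fun z ⟨hzK, hzQ⟩ l hl hne => ⟨hmaps l hl hzK, hzQ ▸ h.eq_min_of_maskFun_ne_zero htr
      (fun l hl => hzQ ▸ hmin (hmaps l hl hzK)) hl hne⟩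
  have hZ : Z.Finite := by
    refine (finite_setOf_exists_maskFun_div_pow_eq_zero h.two_le h.nonempty_left K).subset
      fun z hz => ⟨hz.1, ?_⟩
    by_contra! hne
    have h0 : Q 0 = Q z₀ := apply_zero_eq_of_forall_maskFun_ne_zero h.two_le hQ (fun z hz => hz.2)
      (fun z hz => by simpa using hstep z hz 0 hL) hz hne
    exact hQz₀.not_ge (h0 ▸ hcyc _ (isExtremeCycle_singleton_zero h.nonempty_left hL) 0 rfl)
  obtain ⟨C, hC, x, hxC, hxZ⟩ := h.exists_isExtremeCycle_of_finite hZ ⟨z₀, hz₀, rfl⟩ hstep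
  exact hQz₀.not_ge (hxZ.2 ▸ hcyc C hC x hxC)

end IsHadamardTriple

end ExtremeCycles

/-! ### Fourier transforms of measures -/

section FourierHat

variable {μ : Measure ℝ}

/-- The Fourier transform `t ↦ ∫ e^{2πitx} dμ(x)` of a measure, with the sign and normalization
for which the transform of a self-similar measure is an infinite product of masks. -/
noncomputable def fourierHat (μ : Measure ℝ) (t : ℝ) : ℂ := ∫ x, (𝐞 (t * x) : ℂ) ∂μ

theorem fourierHat_eq_charFun (μ : Measure ℝ) (t : ℝ) :
    fourierHat μ t = charFun μ (2 * Real.pi * t) := by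
  simp only [fourierHat, charFun_apply_real, Real.fourierChar_apply]
  push_cast
  simp only [mul_assoc]

theorem fourierHat_zero (μ : Measure ℝ) [IsProbabilityMeasure μ] : fourierHat μ 0 = 1 := by
  simp [fourierHat]

theorem continuous_fourierHat (μ : Measure ℝ) [IsFiniteMeasure μ] : Continuous (fourierHat μ) := by
  simp only [funext (fourierHat_eq_charFun μ)]
  exact continuous_charFun.comp (continuous_const_mul _)

theorem ext_of_fourierHat {ν : Measure ℝ} [IsFiniteMeasure μ] [IsFiniteMeasure ν]
    (h : fourierHat μ = fourierHat ν) : μ = ν := by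
  refine Measure.ext_of_charFun (funext fun t => ?_)
  have ht : t = 2 * Real.pi * (t / (2 * Real.pi)) := by field_simp
  rw [ht, ← fourierHat_eq_charFun, h, fourierHat_eq_charFun]

theorem continuous_fourierChar_const_mul (t : ℝ) : Continuous fun x : ℝ => (𝐞 (t * x) : ℂ) := by
  fun_prop

theorem integrable_mul_fourierChar {f : ℝ → ℂ} (hf : Integrable f μ) (t : ℝ) :
    Integrable (fun x => f x * (𝐞 (t * x) : ℂ)) μ :=
  hf.mul_bdd (c := 1) (continuous_fourierChar_const_mul t).aestronglyMeasurable
    (Eventually.of_forall fun _ => (Circle.norm_coe _).le)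

theorem integrable_ofReal_mul_fourierChar {g : ℝ → ℝ} (hg : Integrable g μ) (t : ℝ) :
    Integrable (fun x => (g x : ℂ) * (𝐞 (t * x) : ℂ)) μ :=
  integrable_mul_fourierChar hg.ofReal t

theorem fourierHat_withDensity_ofReal {g : ℝ → ℝ} (hg : Integrable g μ) (t : ℝ) :
    fourierHat (μ.withDensity fun x => ENNReal.ofReal (g x)) t =
      ∫ x, ((max (g x) 0 : ℝ) : ℂ) * (𝐞 (t * x) : ℂ) ∂μ := by
  rw [fourierHat, integral_withDensity_eq_integral_toReal_smul₀
    hg.aemeasurable.ennreal_ofReal (by simp)]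
  simp only [ENNReal.toReal_ofReal', Complex.real_smul]

theorem ae_eq_zero_of_integral_ofReal_mul_fourierChar_eq_zero {g : ℝ → ℝ} (hg : Integrable g μ)
    (h : ∀ t : ℝ, ∫ x, (g x : ℂ) * (𝐞 (t * x) : ℂ) ∂μ = 0) : g =ᵐ[μ] 0 := by
  have := isFiniteMeasure_withDensity_ofReal hg.2
  have := isFiniteMeasure_withDensity_ofReal hg.neg.2
  -- The positive and the negative part of `g` are densities of measures with equal transforms.
  have hparts : (μ.withDensity fun x => ENNReal.ofReal (g x)) =
      μ.withDensity fun x => ENNReal.ofReal ((-g) x) := by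
    refine ext_of_fourierHat (funext fun t => ?_)
    rw [fourierHat_withDensity_ofReal hg, fourierHat_withDensity_ofReal hg.neg, ← sub_eq_zero,
      ← integral_sub (integrable_ofReal_mul_fourierChar hg.pos_part t)
        (integrable_ofReal_mul_fourierChar hg.neg.pos_part t), ← h t]
    simp only [← sub_mul, ← Complex.ofReal_sub, Pi.neg_apply,
      max_zero_sub_max_neg_zero_eq_self]
  have hfinite : ∫⁻ x, ENNReal.ofReal (g x) ∂μ ≠ ⊤ :=
    ne_top_of_le_ne_top hg.2.ne (lintegral_mono fun _ => Real.ofReal_le_enorm _)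
  filter_upwards [(withDensity_eq_iff hg.aemeasurable.ennreal_ofReal
    hg.neg.aemeasurable.ennreal_ofReal hfinite).1 hparts] with x hx
  rcases le_total (g x) 0 with h0 | h0
  · rw [ENNReal.ofReal_of_nonpos h0, eq_comm, ENNReal.ofReal_eq_zero, Pi.neg_apply] at hx
    exact le_antisymm h0 (neg_nonpos.1 hx)
  · rw [Pi.neg_apply, ENNReal.ofReal_of_nonpos (neg_nonpos.2 h0), ENNReal.ofReal_eq_zero] at hx
    exact le_antisymm hx h0

theorem ae_re_eq_zero_of_integral_mul_fourierChar_eq_zero {f : ℝ → ℂ} (hf : Integrable f μ)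
    (h : ∀ t : ℝ, ∫ x, f x * (𝐞 (t * x) : ℂ) ∂μ = 0) : (fun x => (f x).re) =ᵐ[μ] 0 := by
  have hconj (t : ℝ) : ∫ x, conj (f x) * (𝐞 (t * x) : ℂ) ∂μ = 0 := by
    rw [← map_zero conj, ← h (-t), ← integral_conj]
    simp [AddChar.map_neg_eq_inv]
  have hfconj : Integrable (fun x => conj (f x)) μ :=
    Complex.conjCLE.toContinuousLinearMap.integrable_comp hf
  refine ae_eq_zero_of_integral_ofReal_mul_fourierChar_eq_zero hf.re fun t => ?_
  simp only [Complex.re_eq_add_conj, div_mul_eq_mul_div, add_mul]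
  rw [integral_div, integral_add (integrable_mul_fourierChar hf t)
    (integrable_mul_fourierChar hfconj t), h, hconj, add_zero, zero_div]

theorem ae_eq_zero_of_integral_mul_fourierChar_eq_zero {f : ℝ → ℂ} (hf : Integrable f μ)
    (h : ∀ t : ℝ, ∫ x, f x * (𝐞 (t * x) : ℂ) ∂μ = 0) : f =ᵐ[μ] 0 := by
  have hI (t : ℝ) : ∫ x, Complex.I * f x * (𝐞 (t * x) : ℂ) ∂μ = 0 := by
    simp only [mul_assoc, integral_const_mul, h, mul_zero]
  filter_upwards [ae_re_eq_zero_of_integral_mul_fourierChar_eq_zero hf h,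
    ae_re_eq_zero_of_integral_mul_fourierChar_eq_zero (hf.const_mul Complex.I) hI] with x hre him
  exact Complex.ext hre (by simpa using him)

end FourierHat

/-! ### Exponentials in `L²(μ)` -/

section ExpLp

variable {μ : Measure ℝ} [IsFiniteMeasure μ]

theorem memLp_fourierChar (μ : Measure ℝ) [IsFiniteMeasure μ] (t : ℝ) :
    MemLp (fun x => (𝐞 (t * x) : ℂ)) 2 μ :=
  MemLp.of_bound (continuous_fourierChar_const_mul t).aestronglyMeasurable 1
    (Eventually.of_forall fun _ => (Circle.norm_coe _).le)

/-- The exponential `x ↦ e^{2πitx}` as an element of `L²(μ)`. -/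
noncomputable def expLp (μ : Measure ℝ) [IsFiniteMeasure μ] (t : ℝ) : Lp ℂ 2 μ :=
  (memLp_fourierChar μ t).toLp _

theorem coeFn_expLp (μ : Measure ℝ) [IsFiniteMeasure μ] (t : ℝ) :
    (expLp μ t : ℝ → ℂ) =ᵐ[μ] fun x => (𝐞 (t * x) : ℂ) := MemLp.coeFn_toLp _

theorem inner_expLp (μ : Measure ℝ) [IsFiniteMeasure μ] (s t : ℝ) :
    inner ℂ (expLp μ s) (expLp μ t) = fourierHat μ (t - s) := by
  rw [L2.inner_def, fourierHat]
  refine integral_congr_ae ?_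
  filter_upwards [coeFn_expLp μ s, coeFn_expLp μ t] with x hs ht
  rw [hs, ht, RCLike.inner_apply, sub_mul, AddChar.map_sub_eq_div, div_eq_mul_inv,
    Circle.coe_mul, Circle.coe_inv_eq_conj]

theorem norm_expLp (μ : Measure ℝ) [IsProbabilityMeasure μ] (t : ℝ) : ‖expLp μ t‖ = 1 := by
  have h := inner_self_eq_norm_sq (𝕜 := ℂ) (expLp μ t)
  rw [inner_expLp, sub_self, fourierHat_zero, RCLike.one_re] at h
  exact (pow_eq_one_iff_of_nonneg (norm_nonneg _) two_ne_zero).1 h.symm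

theorem continuous_expLp (μ : Measure ℝ) [IsProbabilityMeasure μ] : Continuous (expLp μ) := by
  refine continuous_iff_continuousAt.2 fun s => tendsto_iff_norm_sub_tendsto_zero.2 ?_
  have hdist (t : ℝ) :
      ‖expLp μ t - expLp μ s‖ = Real.sqrt (2 - 2 * (fourierHat μ (s - t)).re) := by
    rw [← Real.sqrt_sq (norm_nonneg (expLp μ t - expLp μ s)), norm_sub_sq (𝕜 := ℂ),
      inner_expLp, norm_expLp, norm_expLp, RCLike.re_to_complex]
    ring_nf
  have hcont : Continuous fun t => Real.sqrt (2 - 2 * (fourierHat μ (s - t)).re) := by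
    have := continuous_fourierHat μ
    fun_prop
  simpa [hdist, fourierHat_zero] using hcont.tendsto s

theorem eq_zero_of_forall_inner_expLp {f : Lp ℂ 2 μ} (h : ∀ t, inner ℂ f (expLp μ t) = 0) :
    f = 0 := by
  have hf : Integrable (fun x => conj (f x)) μ :=
    Complex.conjCLE.toContinuousLinearMap.integrable_comp ((Lp.memLp f).integrable one_le_two)
  have hconj := ae_eq_zero_of_integral_mul_fourierChar_eq_zero hf fun t => by
    rw [← h t, L2.inner_def]
    refine integral_congr_ae ?_
    filter_upwards [coeFn_expLp μ t] with x hx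
    rw [hx, RCLike.inner_apply, mul_comm]
  rw [Lp.eq_zero_iff_ae_eq_zero]
  filter_upwards [hconj] with x hx
  simpa using hx

end ExpLp

/-! ### The criterion of Jorgensen and Pedersen -/

section Orthonormal

variable {𝕜 E ι : Type*} [RCLike 𝕜] [NormedAddCommGroup E] [InnerProductSpace 𝕜 E]
  [CompleteSpace E] {v : ι → E}

theorem hasSum_norm_inner_sq_of_orthonormal (hv : Orthonormal 𝕜 v) (x : E) :
    HasSum (fun i => ‖inner 𝕜 (v i) x‖ ^ 2)
      (‖hv.orthogonalFamily.linearIsometry.toContinuousLinearMap.adjoint x‖ ^ 2) := by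
  classical
  set T := hv.orthogonalFamily.linearIsometry.toContinuousLinearMap
  have hcoord (i : ι) : T.adjoint x i = inner 𝕜 (v i) x := by
    have h := lp.inner_single_left (𝕜 := 𝕜) (G := fun _ : ι => 𝕜) i (1 : 𝕜) (T.adjoint x)
    rw [ContinuousLinearMap.adjoint_inner_right, LinearIsometry.coe_toContinuousLinearMap,
      OrthogonalFamily.linearIsometry_apply_single, LinearIsometry.toSpanSingleton_apply,
      one_smul] at h
    simpa using h.symm
  simpa [hcoord] using lp.hasSum_norm (p := 2) (by norm_num) (T.adjoint x)

theorem continuous_tsum_norm_inner_sq (hv : Orthonormal 𝕜 v) :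
    Continuous fun x : E => ∑' i, ‖inner 𝕜 (v i) x‖ ^ 2 := by
  simp only [(hasSum_norm_inner_sq_of_orthonormal hv _).tsum_eq]
  fun_prop

theorem mem_closure_span_of_norm_sq_le_tsum (hv : Orthonormal 𝕜 v) {x : E}
    (hx : ‖x‖ ^ 2 ≤ ∑' i, ‖inner 𝕜 (v i) x‖ ^ 2) :
    x ∈ (Submodule.span 𝕜 (Set.range v)).topologicalClosure := by
  set K := (Submodule.span 𝕜 (Set.range v)).topologicalClosure
  have hvK (i : ι) : v i ∈ K :=
    Submodule.le_topologicalClosure _ (Submodule.subset_span (Set.mem_range_self i))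
  have hinner (i : ι) : inner 𝕜 (v i) (K.starProjection x) = inner 𝕜 (v i) x := by
    rw [← Submodule.inner_starProjection_left_eq_right,
      Submodule.starProjection_eq_self_iff.2 (hvK i)]
  have hbessel := hv.tsum_inner_products_le (x := K.starProjection x)
  simp only [hinner] at hbessel
  exact (K.mem_iff_norm_starProjection x).2 <| le_antisymm (K.norm_starProjection_apply_le x)
    (le_of_sq_le_sq (hx.trans hbessel) (norm_nonneg _))

end Orthonormal

section SpectralSum

variable {μ : Measure ℝ} [IsProbabilityMeasure μ] {Λ : Set ℝ}

/-- The function `t ↦ ∑_{s ∈ Λ} |μ̂(t + s)|²`. When the exponentials `e^{2πisx}`, `s ∈ Λ`, are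
orthogonal in `L²(μ)`, its value at `t` is the squared norm of the projection of `e^{-2πitx}` to
their closed span. -/
noncomputable def spectralSum (μ : Measure ℝ) (Λ : Set ℝ) (t : ℝ) : ℝ :=
  ∑' s : Λ, ‖fourierHat μ (t + s)‖ ^ 2

theorem norm_inner_expLp_neg (μ : Measure ℝ) [IsFiniteMeasure μ] (s t : ℝ) :
    ‖inner ℂ (expLp μ s) (expLp μ (-t))‖ = ‖fourierHat μ (t + s)‖ := by
  rw [norm_inner_symm, inner_expLp, sub_neg_eq_add, add_comm]

theorem orthonormal_expLp (horth : ∀ s ∈ Λ, ∀ s' ∈ Λ, s ≠ s' → fourierHat μ (s - s') = 0) :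
    Orthonormal ℂ fun s : Λ => expLp μ s := by
  refine ⟨fun s => norm_expLp μ s, fun s s' hne => ?_⟩
  simp only [inner_expLp]
  exact horth s' s'.2 s s.2 (Subtype.coe_ne_coe.2 hne.symm)

theorem spectralSum_eq_tsum_norm_inner_sq (μ : Measure ℝ) [IsFiniteMeasure μ] (Λ : Set ℝ) (t : ℝ) :
    spectralSum μ Λ t = ∑' s : Λ, ‖inner ℂ (expLp μ s) (expLp μ (-t))‖ ^ 2 := by
  simp only [spectralSum, norm_inner_expLp_neg]

theorem hasSum_spectralSum
    (horth : ∀ s ∈ Λ, ∀ s' ∈ Λ, s ≠ s' → fourierHat μ (s - s') = 0) (t : ℝ) :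
    HasSum (fun s : Λ => ‖fourierHat μ (t + s)‖ ^ 2) (spectralSum μ Λ t) := by
  have h := (orthonormal_expLp horth).inner_products_summable (x := expLp μ (-t))
  simp only [norm_inner_expLp_neg] at h
  exact h.hasSum

theorem continuous_spectralSum
    (horth : ∀ s ∈ Λ, ∀ s' ∈ Λ, s ≠ s' → fourierHat μ (s - s') = 0) :
    Continuous (spectralSum μ Λ) := by
  simp only [funext (spectralSum_eq_tsum_norm_inner_sq μ Λ)]
  exact (continuous_tsum_norm_inner_sq (orthonormal_expLp horth)).comp
    ((continuous_expLp μ).comp continuous_neg)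

theorem isSpectralPair_of_one_le_spectralSum (hΛ : Λ.Countable)
    (horth : ∀ s ∈ Λ, ∀ s' ∈ Λ, s ≠ s' → fourierHat μ (s - s') = 0)
    (hsum : ∀ t, 1 ≤ spectralSum μ Λ t) : IsSpectralPair μ Λ := by
  have hv := orthonormal_expLp horth
  have hmem (t : ℝ) : expLp μ t ∈
      (Submodule.span ℂ (Set.range fun s : Λ => expLp μ s)).topologicalClosure := by
    refine mem_closure_span_of_norm_sq_le_tsum hv ?_
    have h := hsum (-t)
    rwa [spectralSum_eq_tsum_norm_inner_sq, neg_neg, ← one_pow 2, ← norm_expLp μ t] at h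
  have hbot : (Submodule.span ℂ (Set.range fun s : Λ => expLp μ s))ᗮ = ⊥ := by
    rw [← Submodule.orthogonal_closure, Submodule.eq_bot_iff]
    exact fun f hf => eq_zero_of_forall_inner_expLp fun t =>
      (Submodule.mem_orthogonal' _ _).1 hf _ (hmem t)
  refine ⟨inferInstance, hΛ, HilbertBasis.mkOfOrthogonalEqBot hv hbot, fun s => ?_⟩
  rw [HilbertBasis.coe_mkOfOrthogonalEqBot]
  filter_upwards [coeFn_expLp μ s] with x hx
  rw [hx, Real.fourierChar_apply]
  push_cast
  ring_nf

end SpectralSum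

/-! ### The canonical spectrum -/

section CanonicalSpectrum

variable {N : ℕ} {B L : Finset ℤ}

theorem countable_digitDual {b : ℤ} (hb : b ∈ B) (hb0 : b ≠ 0) :
    (digitDual B : Set ℝ).Countable := by
  refine (Set.countable_range fun n : ℤ => (n : ℝ) / b).mono fun x hx => ?_
  obtain ⟨n, hn⟩ := hx b hb
  exact ⟨n, by simp only [← hn, mul_div_cancel_left₀ x (Int.cast_ne_zero.2 hb0 : (b : ℝ) ≠ 0)]⟩

theorem IsExtremeCycle.subset_digitDual (h0 : (0 : ℤ) ∈ B) {C : Set ℝ}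
    (hC : IsExtremeCycle N B L C) : C ⊆ digitDual B := by
  obtain ⟨k, x, l, rfl, -, -, hone⟩ := hC
  rintro _ ⟨j, rfl⟩
  exact (norm_maskFun_eq_one_iff h0).1 (hone j)

theorem IsExtremeCycle.exists_ifsMap_mem {C : Set ℝ} (hC : IsExtremeCycle N B L C) {x : ℝ}
    (hx : x ∈ C) : ∃ l ∈ L, ifsMap N l x ∈ C := by
  obtain ⟨k, y, l, rfl, hl, hstep, -⟩ := hC
  obtain ⟨j, rfl⟩ := hx
  exact ⟨l j, hl j, j + 1, (hstep j).symm⟩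

theorem IsExtremeCycle.neg_mem_canonicalSpectrum {C : Set ℝ} (hC : IsExtremeCycle N B L C) {x : ℝ}
    (hx : x ∈ C) : -x ∈ canonicalSpectrum N B L :=
  Set.mem_sInter.2 fun _ hS => hS.1 C hC x hx

theorem mul_add_mem_canonicalSpectrum {s : ℝ} (hs : s ∈ canonicalSpectrum N B L) {l : ℤ}
    (hl : l ∈ L) : (N : ℝ) * s + l ∈ canonicalSpectrum N B L :=
  Set.mem_sInter.2 fun S hS => hS.2 s (Set.mem_sInter.1 hs S hS) l hl

theorem canonicalSpectrum_subset {S : Set ℝ} (hcyc : ∀ C, IsExtremeCycle N B L C → ∀ x ∈ C, -x ∈ S)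
    (hstep : ∀ s ∈ S, ∀ l ∈ L, (N : ℝ) * s + (l : ℝ) ∈ S) : canonicalSpectrum N B L ⊆ S :=
  Set.sInter_subset_of_mem ⟨hcyc, hstep⟩

theorem canonicalSpectrum_subset_digitDual (h0 : (0 : ℤ) ∈ B) :
    canonicalSpectrum N B L ⊆ digitDual B := by
  refine canonicalSpectrum_subset (fun C hC x hx => neg_mem (hC.subset_digitDual h0 hx))
    fun s hs l _ => ?_
  rw [← nsmul_eq_mul]
  exact add_mem (nsmul_mem hs N) (intCast_mem_digitDual l)

theorem exists_eq_mul_add_of_mem_canonicalSpectrum (hN : N ≠ 0) {s : ℝ}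
    (hs : s ∈ canonicalSpectrum N B L) :
    ∃ s' ∈ canonicalSpectrum N B L, ∃ l ∈ L, s = N * s' + l := by
  refine (canonicalSpectrum_subset (S := {s | s ∈ canonicalSpectrum N B L ∧
    ∃ s' ∈ canonicalSpectrum N B L, ∃ l ∈ L, s = N * s' + (l : ℤ)})
    (fun C hC x hx => ⟨hC.neg_mem_canonicalSpectrum hx, ?_⟩) (fun s hs l hl =>
      ⟨mul_add_mem_canonicalSpectrum hs.1 hl, s, hs.1, l, hl, rfl⟩) hs).2
  obtain ⟨l, hl, hy⟩ := hC.exists_ifsMap_mem hx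
  refine ⟨-ifsMap N l x, hC.neg_mem_canonicalSpectrum hy, l, hl, ?_⟩
  have hN0 : (N : ℝ) ≠ 0 := Nat.cast_ne_zero.2 hN
  rw [ifsMap]
  field_simp
  ring

theorem IsSelfSimilarMeasure.fourierHat_eq {μ : Measure ℝ} (h : IsSelfSimilarMeasure N B μ)
    (t : ℝ) : fourierHat μ t = maskFun B (t / N) * fourierHat μ (t / N) := by
  have hsum : ∑ b ∈ B, Complex.exp ((2 * Real.pi * t : ℝ) * (b / N) * Complex.I)
      = ∑ b ∈ B, Complex.exp (2 * Real.pi * Complex.I * (b * ((t / N : ℝ) : ℂ))) :=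
    Finset.sum_congr rfl fun b _ => by push_cast; ring_nf
  rw [fourierHat_eq_charFun, fourierHat_eq_charFun, h.charFun_eq, ← Finset.sum_mul, hsum,
    ← mul_assoc, mul_div_assoc, maskFun]

theorem mul_add_sub_mul_add_div (hN : N ≠ 0) (s s' : ℝ) (l l' : ℤ) :
    (N * s + l - (N * s' + l')) / N = ((l - l') / N : ℝ) + (s - s') := by
  have hN0 : (N : ℝ) ≠ 0 := Nat.cast_ne_zero.2 hN
  field_simp
  ring

namespace IsHadamardTriple

theorem ne_zero (h : IsHadamardTriple N B L) : N ≠ 0 := (two_pos.trans_le h.two_le).ne'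

theorem exists_mem_ne_zero (h : IsHadamardTriple N B L) : ∃ b ∈ B, b ≠ 0 :=
  (Finset.one_lt_card_iff_nontrivial.1 h.two_le_card).exists_ne 0

theorem fourierHat_sub_eq_zero (h : IsHadamardTriple N B L) (h0 : (0 : ℤ) ∈ B) {μ : Measure ℝ}
    (hμ : IsSelfSimilarMeasure N B μ) {s s' : ℝ} (hs : s ∈ canonicalSpectrum N B L)
    (hs' : s' ∈ canonicalSpectrum N B L) (hne : s ≠ s') : fourierHat μ (s - s') = 0 := by
  have hN : (2 : ℝ) ≤ N := Nat.ofNat_le_cast.2 h.two_le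
  obtain ⟨b, hb, hb0⟩ := h.exists_mem_ne_zero
  have hdual {r r' : ℝ} (hr : r ∈ canonicalSpectrum N B L) (hr' : r' ∈ canonicalSpectrum N B L) :
      r - r' ∈ digitDual B :=
    sub_mem (canonicalSpectrum_subset_digitDual h0 hr) (canonicalSpectrum_subset_digitDual h0 hr')
  -- As long as the digits agree, passing to the quotients divides the integer `b (s - s')` by `N`.
  obtain ⟨n, hn⟩ : ∃ n : ℕ, |(b : ℝ) * (s - s')| < 2 ^ n := pow_unbounded_of_one_lt _ one_lt_two
  induction n generalizing s s' with
  | zero =>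
    obtain ⟨m, hm⟩ := hdual hs hs' b hb
    rw [hm, pow_zero] at hn
    have hm0 : m = 0 := Int.abs_lt_one_iff.1 (by exact_mod_cast hn)
    rw [hm0, Int.cast_zero, mul_eq_zero, Int.cast_eq_zero, sub_eq_zero] at hm
    exact absurd hm (not_or_intro hb0 hne)
  | succ n ih =>
    obtain ⟨r, hr, l, hl, rfl⟩ := exists_eq_mul_add_of_mem_canonicalSpectrum h.ne_zero hs
    obtain ⟨r', hr', l', hl', rfl⟩ := exists_eq_mul_add_of_mem_canonicalSpectrum h.ne_zero hs'
    rw [hμ.fourierHat_eq, mul_add_sub_mul_add_div h.ne_zero,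
      maskFun_add_of_mem_digitDual (hdual hr hr')]
    rcases eq_or_ne l l' with rfl | hll
    · rw [add_sub_add_right_eq_sub, ← mul_sub, mul_left_comm, abs_mul, Nat.abs_cast, pow_succ] at hn
      rw [sub_self, zero_div, zero_add, ih hr hr' (fun e => hne (by rw [e])), mul_zero]
      nlinarith [abs_nonneg ((b : ℝ) * (r - r'))]
    · rw [h.maskFun_eq_zero hl hl' hll, zero_mul]

theorem bijective_mul_add_canonicalSpectrum (h : IsHadamardTriple N B L) (h0 : (0 : ℤ) ∈ B) :
    Function.Bijective fun z : L × canonicalSpectrum N B L =>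
      (⟨N * z.2 + (z.1 : ℤ), mul_add_mem_canonicalSpectrum z.2.2 z.1.2⟩ :
        canonicalSpectrum N B L) := by
  constructor
  · rintro ⟨⟨l, hl⟩, ⟨s, hs⟩⟩ ⟨⟨l', hl'⟩, ⟨s', hs'⟩⟩ heq
    have heq : (N : ℝ) * s + l = N * s' + l' := congrArg Subtype.val heq
    have hll : l = l' := by
      by_contra hne
      have hdiv := mul_add_sub_mul_add_div h.ne_zero s s' l l'
      rw [heq, sub_self, zero_div] at hdiv
      have hmask := maskFun_add_of_mem_digitDual (B := B)
        (sub_mem (canonicalSpectrum_subset_digitDual h0 hs)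
          (canonicalSpectrum_subset_digitDual h0 hs')) ((l - l') / N)
      rw [← hdiv, maskFun_zero ⟨0, h0⟩, h.maskFun_eq_zero hl hl' hne] at hmask
      exact one_ne_zero hmask
    subst hll
    obtain rfl : s = s' := mul_left_cancel₀ h.natCast_pos.ne' (add_right_cancel heq)
    rfl
  · rintro ⟨s, hs⟩
    obtain ⟨s', hs', l, hl, rfl⟩ := exists_eq_mul_add_of_mem_canonicalSpectrum h.ne_zero hs
    exact ⟨⟨⟨l, hl⟩, ⟨s', hs'⟩⟩, rfl⟩

theorem spectralSum_eq_sum (h : IsHadamardTriple N B L) (h0 : (0 : ℤ) ∈ B) {μ : Measure ℝ}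
    (hμ : IsSelfSimilarMeasure N B μ) (t : ℝ) :
    spectralSum μ (canonicalSpectrum N B L) t = ∑ l ∈ L, ‖maskFun B (ifsMap N l t)‖ ^ 2 *
      spectralSum μ (canonicalSpectrum N B L) (ifsMap N l t) := by
  have := hμ.1
  have hsum := hasSum_spectralSum (μ := μ) fun s hs s' hs' hne =>
    h.fourierHat_sub_eq_zero h0 hμ hs hs' hne
  have hterm (l : ℤ) {s : ℝ} (hs : s ∈ canonicalSpectrum N B L) :
      ‖fourierHat μ (t + (N * s + l))‖ ^ 2 =
        ‖maskFun B (ifsMap N l t)‖ ^ 2 * ‖fourierHat μ (ifsMap N l t + s)‖ ^ 2 := by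
    have hdiv : (t + (N * s + l)) / N = ifsMap N l t + s := by
      have := h.natCast_pos.ne'
      rw [ifsMap]
      field_simp
      ring
    rw [hμ.fourierHat_eq, hdiv, maskFun_add_of_mem_digitDual
      (canonicalSpectrum_subset_digitDual h0 hs), norm_mul, mul_pow]
  have hprod :=
    (Equiv.ofBijective _ (h.bijective_mul_add_canonicalSpectrum h0)).hasSum_iff.2 (hsum t)
  have hfiber := hprod.prod_fiberwise fun l => by
    simpa only [Function.comp_def, Equiv.ofBijective_apply, hterm l (Subtype.coe_prop _)] using
      (hsum (ifsMap N (l : L) t)).mul_left (‖maskFun B (ifsMap N (l : L) t)‖ ^ 2)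
  rw [hfiber.unique (hasSum_fintype _)]
  exact Finset.sum_coe_sort L fun l => ‖maskFun B (ifsMap N l t)‖ ^ 2 *
    spectralSum μ (canonicalSpectrum N B L) (ifsMap N l t)

theorem isSpectralPair (h : IsHadamardTriple N B L) (hB : (0 : ℤ) ∈ B) (hL : (0 : ℤ) ∈ L) :
    IsSpectralPair (selfSimilarMeasure N B) (canonicalSpectrum N B L) := by
  have hμ := h.isSelfSimilarMeasure
  have := hμ.1
  have horth : ∀ s ∈ canonicalSpectrum N B L, ∀ s' ∈ canonicalSpectrum N B L, s ≠ s' →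
      fourierHat (selfSimilarMeasure N B) (s - s') = 0 :=
    fun s hs s' hs' => h.fourierHat_sub_eq_zero hB hμ hs hs'
  have hcyc (C : Set ℝ) (hC : IsExtremeCycle N B L C) (x : ℝ) (hx : x ∈ C) :
      1 ≤ spectralSum (selfSimilarMeasure N B) (canonicalSpectrum N B L) x := by
    have hle := le_hasSum (hasSum_spectralSum horth x) ⟨-x, hC.neg_mem_canonicalSpectrum hx⟩
      fun _ _ => by positivity
    simpa [fourierHat_zero] using hle
  obtain ⟨b, hb, hb0⟩ := h.exists_mem_ne_zero
  exact isSpectralPair_of_one_le_spectralSum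
    ((countable_digitDual hb hb0).mono (canonicalSpectrum_subset_digitDual hB)) horth
    (h.one_le_of_transfer_eq hL (continuous_spectralSum horth) (h.spectralSum_eq_sum hB hμ) hcyc)

end IsHadamardTriple

end CanonicalSpectrum

/-! ### Multiples of the canonical spectrum -/

theorem card_le_of_forall_exists_abs_sub_le {ι : Type*} {F : Finset ι} {f : ι → ℝ} {r : ℝ}
    (hr : 0 ≤ r) {Y : Finset ℤ} (hY : ∀ n ∈ Y, ∃ c ∈ F, |(n : ℝ) - f c| ≤ r) :
    (Y.card : ℝ) ≤ F.card * (2 * r + 1) := by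
  classical
  have hsub : Y ⊆ F.biUnion fun c => Finset.Icc ⌈f c - r⌉ ⌊f c + r⌋ := fun n hn => by
    obtain ⟨c, hc, hnc⟩ := hY n hn
    rw [abs_le] at hnc
    exact Finset.mem_biUnion.2 ⟨c, hc, Finset.mem_Icc.2
      ⟨Int.ceil_le.2 (by linarith), Int.le_floor.2 (by linarith)⟩⟩
  have hone (c : ι) : ((Finset.Icc ⌈f c - r⌉ ⌊f c + r⌋).card : ℝ) ≤ 2 * r + 1 := by
    rw [Int.card_Icc, ← Int.cast_natCast, Int.ofNat_toNat, Int.cast_max]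
    refine max_le ?_ (by push_cast; positivity)
    push_cast
    linarith [Int.floor_le (f c + r), Int.le_ceil (f c - r)]
  calc (Y.card : ℝ) ≤ ∑ c ∈ F, ((Finset.Icc ⌈f c - r⌉ ⌊f c + r⌋).card : ℝ) := by
        exact_mod_cast (Finset.card_le_card hsub).trans Finset.card_biUnion_le
    _ ≤ F.card * (2 * r + 1) := by
        rw [← nsmul_eq_mul]
        exact Finset.sum_le_card_nsmul _ _ _ fun c _ => hone c

theorem orderOf_le_card_of_forall_exists_eq_mul {R : Type*} [CommRing R] [IsDomain R] {u y₀ : R}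
    {Y : Finset R} (hY : ∀ y ∈ Y, u * y ∈ Y) (hy₀ : y₀ ∈ Y) (hne : y₀ ≠ 0) :
    orderOf u ≤ Y.card := by
  have hmem (i : ℕ) : u ^ i * y₀ ∈ Y := by
    induction i with
    | zero => rwa [pow_zero, one_mul]
    | succ i ih => rw [pow_succ', mul_assoc]; exact hY _ ih
  have hinj : Set.InjOn (fun i : ℕ => u ^ i * y₀) (Finset.range (orderOf u)) := by
    intro i hi j hj hij
    rw [Finset.coe_range] at hi hj
    exact pow_injOn_Iio_orderOf hi hj (mul_right_cancel₀ hne hij)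
  simpa only [Finset.card_range] using
    Finset.card_le_card_of_injOn _ (fun i _ => hmem i) hinj

section Multiples

variable {N : ℕ} {B L : Finset ℤ} {C : Set ℝ}

theorem exists_finset_forall_abs_sub_le_div_pow (hN : N ≠ 0) {T : ℝ} (hT : ∀ x ∈ C, |x| ≤ T)
    (hC : ∀ x ∈ C, ∃ y ∈ C, ∃ l ∈ L, x = ifsMap N l y) (n : ℕ) :
    ∃ F : Finset ℝ, F.card ≤ L.card ^ n ∧ ∀ x ∈ C, ∃ c ∈ F, |x - c| ≤ T / (N : ℝ) ^ n := by
  classical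
  induction n with
  | zero => exact ⟨{0}, by simp, fun x hx => ⟨0, by simp, by simpa using hT x hx⟩⟩
  | succ n ih =>
    obtain ⟨F, hcard, hF⟩ := ih
    refine ⟨(F ×ˢ L).image fun z => ifsMap N z.2 z.1, ?_, fun x hx => ?_⟩
    · refine Finset.card_image_le.trans ?_
      rw [Finset.card_product, pow_succ]
      exact Nat.mul_le_mul_right _ hcard
    · obtain ⟨y, hy, l, hl, rfl⟩ := hC x hx
      obtain ⟨c, hc, hyc⟩ := hF y hy
      refine ⟨ifsMap N l c, Finset.mem_image.2 ⟨(c, l), Finset.mem_product.2 ⟨hc, hl⟩, rfl⟩, ?_⟩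
      rw [ifsMap, ifsMap, ← sub_div, add_sub_add_right_eq_sub, abs_div, Nat.abs_cast, pow_succ,
        ← div_div]
      gcongr

namespace IsExtremeCycle

theorem finite (hC : IsExtremeCycle N B L C) : C.Finite := by
  obtain ⟨k, x, l, rfl, -⟩ := hC
  exact Set.finite_range x

theorem exists_eq_ifsMap (hC : IsExtremeCycle N B L C) {x : ℝ} (hx : x ∈ C) :
    ∃ y ∈ C, ∃ l ∈ L, x = ifsMap N l y := by
  obtain ⟨k, x, l, rfl, hl, hstep, -⟩ := hC
  obtain ⟨j, rfl⟩ := hx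
  refine ⟨x (j - 1), ⟨_, rfl⟩, l (j - 1), hl _, ?_⟩
  rw [hstep, sub_add_cancel]

theorem abs_le (hC : IsExtremeCycle N B L C) (hN : 2 ≤ N) {R : ℝ} (hR : ∀ l ∈ L, |(l : ℝ)| ≤ R)
    {x : ℝ} (hx : x ∈ C) : |x| ≤ R := by
  obtain ⟨z, hz, hmax⟩ := Set.exists_max_image C (fun x => |x|) hC.finite ⟨x, hx⟩
  refine (hmax x hx).trans ?_
  obtain ⟨y, hy, l, hl, rfl⟩ := hC.exists_eq_ifsMap hz
  have hN2 : (2 : ℝ) ≤ N := Nat.ofNat_le_cast.2 hN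
  have hmul : |ifsMap N l y| * N = |y + l| := by
    rw [ifsMap, abs_div, Nat.abs_cast, div_mul_cancel₀ _ (by positivity)]
  nlinarith [abs_add_le y l, hmax y hy, hR l hl, abs_nonneg (ifsMap N l y)]

theorem image_mul (hC : IsExtremeCycle N B L C) (h0 : (0 : ℤ) ∈ B) {a : ℝ} {L' : Finset ℤ}
    (hL : ∀ l ∈ L, ∃ l' ∈ L', (l' : ℝ) = a * l) (hdual : ∀ x ∈ C, a * x ∈ digitDual B) :
    IsExtremeCycle N B L' ((fun x => a * x) '' C) := by
  obtain ⟨k, x, l, rfl, hl, hstep, -⟩ := hC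
  choose l' hl' heq using fun j => hL (l j) (hl j)
  refine ⟨k, fun j => a * x j, l', (Set.range_comp _ _).symm, hl', fun j => ?_,
    fun j => (norm_maskFun_eq_one_iff h0).2 (hdual _ ⟨j, rfl⟩)⟩
  beta_reduce
  rw [← hstep, ifsMap, ifsMap, heq, ← mul_add, mul_div_assoc]

theorem orderOf_le_card (hN : N ≠ 0) {p : ℕ} (hp : p.Prime)
    (hC : IsExtremeCycle N B (L.image fun l => (p : ℤ) * l) C) {b : ℤ} {Y : Finset ℤ}
    (hY : ∀ n, n ∈ Y ↔ ∃ x ∈ C, (b : ℝ) * x = n) (hint : ∀ x ∈ C, ∃ n : ℤ, (b : ℝ) * x = n)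
    {n : ℤ} (hn : n ∈ Y) (hdvd : ¬ (p : ℤ) ∣ n) : orderOf (N : ZMod p) ≤ Y.card := by
  classical
  have := Fact.mk hp
  refine (orderOf_le_card_of_forall_exists_eq_mul (Y := Y.image (Int.cast : ℤ → ZMod p)) ?_
    (Finset.mem_image_of_mem _ hn) (mt (ZMod.intCast_zmod_eq_zero_iff_dvd n p).1 hdvd)).trans
    Finset.card_image_le
  rw [Finset.forall_mem_image]
  intro m hm
  obtain ⟨x, hx, hbx⟩ := (hY m).1 hm
  obtain ⟨y, hy, l, hl, rfl⟩ := hC.exists_eq_ifsMap hx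
  obtain ⟨l, -, rfl⟩ := Finset.mem_image.1 hl
  obtain ⟨m', hm'⟩ := hint y hy
  refine Finset.mem_image.2 ⟨m', (hY m').2 ⟨y, hy, hm'⟩, ?_⟩
  have hN0 : (N : ℝ) ≠ 0 := Nat.cast_ne_zero.2 hN
  have hreal : (m' : ℝ) = N * m - p * (b * l) := by
    rw [← hm', ← hbx, ifsMap]
    field_simp
    push_cast
    ring
  have hmod : m' = N * m - p * (b * l) := by exact_mod_cast hreal
  simp [hmod]

theorem card_le_pow_clog_mul (hN : 2 ≤ N) {p : ℕ}
    (hC : IsExtremeCycle N B (L.image fun l => (p : ℤ) * l) C) {D R : ℝ} {b : ℤ}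
    (hD : |(b : ℝ)| ≤ D) (hR0 : 0 ≤ R) (hR : ∀ l ∈ L, |(l : ℝ)| ≤ R) {Y : Finset ℤ}
    (hY : ∀ n ∈ Y, ∃ x ∈ C, (b : ℝ) * x = n) :
    (Y.card : ℝ) ≤ L.card ^ Nat.clog N p * (2 * (D * R) + 1) := by
  have hT : ∀ x ∈ C, |x| ≤ p * R := fun x hx => by
    refine hC.abs_le hN (Finset.forall_mem_image.2 fun l hl => ?_) hx
    rw [Int.cast_mul, Int.cast_natCast, abs_mul, Nat.abs_cast]
    exact mul_le_mul_of_nonneg_left (hR l hl) p.cast_nonneg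
  obtain ⟨F, hFcard, hF⟩ := exists_finset_forall_abs_sub_le_div_pow (two_pos.trans_le hN).ne' hT
    (fun x hx => hC.exists_eq_ifsMap hx) (Nat.clog N p)
  have hrad : p * R / (N : ℝ) ^ Nat.clog N p ≤ R := by
    rw [div_le_iff₀ (by positivity), mul_comm]
    exact mul_le_mul_of_nonneg_left (by exact_mod_cast Nat.le_pow_clog hN p) hR0
  have hD0 : 0 ≤ D := (abs_nonneg _).trans hD
  refine (card_le_of_forall_exists_abs_sub_le (F := F) (f := fun c => b * c)
    (mul_nonneg hD0 hR0) fun n hn => ?_).trans ?_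
  · obtain ⟨x, hx, hbx⟩ := hY n hn
    obtain ⟨c, hc, hxc⟩ := hF x hx
    refine ⟨c, hc, ?_⟩
    rw [← hbx, ← mul_sub, abs_mul]
    exact mul_le_mul hD (hxc.trans hrad) (abs_nonneg _) hD0
  · refine mul_le_mul_of_nonneg_right ?_ (by positivity)
    exact_mod_cast hFcard.trans (Nat.pow_le_pow_left Finset.card_image_le _)

/-- A cycle with digits in `pL` whose elements are not all divisible by `p` contains a full orbit of
multiplication by `N` modulo `p`; but it lies near only `(#L)ⁿ` points, where `Nⁿ ≈ p`. -/
theorem inv_mul_mem_digitDual (hN : 2 ≤ N) (h0 : (0 : ℤ) ∈ B) {p : ℕ} (hp : p.Prime)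
    (hC : IsExtremeCycle N B (L.image fun l => (p : ℤ) * l) C) {D R : ℝ}
    (hD : ∀ b ∈ B, |(b : ℝ)| ≤ D) (hR0 : 0 ≤ R) (hR : ∀ l ∈ L, |(l : ℝ)| ≤ R)
    (hord : (L.card : ℝ) ^ Nat.clog N p * (2 * (D * R) + 1) < orderOf (N : ZMod p))
    {x : ℝ} (hx : x ∈ C) : (p : ℝ)⁻¹ * x ∈ digitDual B := by
  classical
  intro b hb
  have hint : ∀ x ∈ C, ∃ n : ℤ, (b : ℝ) * x = n := fun x hx => hC.subset_digitDual h0 hx b hb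
  choose! f hf using hint
  have hY (n : ℤ) : n ∈ hC.finite.toFinset.image f ↔ ∃ x ∈ C, (b : ℝ) * x = n := by
    simp only [Finset.mem_image, Set.Finite.mem_toFinset]
    exact exists_congr fun x => and_congr_right fun hx => by rw [hf x hx, Int.cast_inj]
  by_cases hdvd : (p : ℤ) ∣ f x
  · obtain ⟨n, hn⟩ := hdvd
    have hp0 : (p : ℝ) ≠ 0 := Nat.cast_ne_zero.2 hp.ne_zero
    refine ⟨n, ?_⟩
    rw [mul_left_comm, hf x hx, hn, Int.cast_mul, Int.cast_natCast, inv_mul_cancel_left₀ hp0]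
  · have hlower := hC.orderOf_le_card (two_pos.trans_le hN).ne' hp hY
      (fun x hx => ⟨f x, hf x hx⟩) ((hY _).2 ⟨x, hx, hf x hx⟩) hdvd
    have hupper := hC.card_le_pow_clog_mul hN (hD b hb) hR0 hR fun n hn => (hY n).1 hn
    exact absurd (hord.trans_le (Nat.cast_le.2 hlower)) hupper.not_gt

end IsExtremeCycle

theorem image_mul_canonicalSpectrum_subset (h0 : (0 : ℤ) ∈ B) {a : ℝ} {L' : Finset ℤ}
    (hL : ∀ l ∈ L, ∃ l' ∈ L', (l' : ℝ) = a * l)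
    (hdual : ∀ C, IsExtremeCycle N B L C → ∀ x ∈ C, a * x ∈ digitDual B) :
    (fun s => a * s) '' canonicalSpectrum N B L ⊆ canonicalSpectrum N B L' := by
  refine Set.image_subset_iff.2 (canonicalSpectrum_subset (fun C hC x hx => ?_)
    fun s hs l hl => ?_)
  · rw [Set.mem_preimage, mul_neg]
    exact (hC.image_mul h0 hL (hdual C hC)).neg_mem_canonicalSpectrum ⟨x, hx, rfl⟩
  · obtain ⟨l', hl', heq⟩ := hL l hl
    rw [Set.mem_preimage, mul_add, mul_left_comm, ← heq]
    exact mul_add_mem_canonicalSpectrum hs hl'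

theorem canonicalSpectrum_image_mul (h0 : (0 : ℤ) ∈ B) {p : ℕ} (hp : p ≠ 0)
    (hdual : ∀ C, IsExtremeCycle N B (L.image fun l => (p : ℤ) * l) C → ∀ x ∈ C,
      (p : ℝ)⁻¹ * x ∈ digitDual B) :
    canonicalSpectrum N B (L.image fun l => (p : ℤ) * l) =
      (fun s => (p : ℝ) * s) '' canonicalSpectrum N B L := by
  have hp0 : (p : ℝ) ≠ 0 := Nat.cast_ne_zero.2 hp
  refine Set.Subset.antisymm (fun s hs => ⟨(p : ℝ)⁻¹ * s, ?_, mul_inv_cancel_left₀ hp0 s⟩) ?_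
  · refine image_mul_canonicalSpectrum_subset h0 (Finset.forall_mem_image.2 fun l hl =>
      ⟨l, hl, ?_⟩) hdual ⟨s, hs, rfl⟩
    rw [Int.cast_mul, Int.cast_natCast, inv_mul_cancel_left₀ hp0]
  · refine image_mul_canonicalSpectrum_subset h0
      (fun l hl => ⟨p * l, Finset.mem_image_of_mem _ hl, by push_cast; rfl⟩) fun C hC x hx => ?_
    rw [← nsmul_eq_mul]
    exact nsmul_mem (hC.subset_digitDual h0 hx) p

theorem IsHadamardTriple.isSpectralEigenvalue_of_lt_orderOf (h : IsHadamardTriple N B L)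
    (hB : (0 : ℤ) ∈ B) (hL : (0 : ℤ) ∈ L) {D R : ℝ} (hD : ∀ b ∈ B, |(b : ℝ)| ≤ D)
    (hR : ∀ l ∈ L, |(l : ℝ)| ≤ R) {p : ℕ} (hp : p.Prime)
    (hord : (L.card : ℝ) ^ Nat.clog N p * (2 * (D * R) + 1) < orderOf (N : ZMod p)) :
    IsSpectralEigenvalue (selfSimilarMeasure N B) (canonicalSpectrum N B L) p := by
  have := Fact.mk hp
  have hD0 : 0 ≤ D := (abs_nonneg _).trans (hD 0 hB)
  have hR0 : 0 ≤ R := (abs_nonneg _).trans (hR 0 hL)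
  have hcop : p.Coprime N := by
    refine hp.coprime_iff_not_dvd.2 fun hdvd => ?_
    rw [(ZMod.natCast_eq_zero_iff N p).2 hdvd, orderOf_zero, Nat.cast_zero] at hord
    exact hord.not_ge (by positivity)
  refine ⟨h.isSpectralPair hB hL, ?_⟩
  rw [← canonicalSpectrum_image_mul hB hp.ne_zero fun C hC x hx =>
    hC.inv_mul_mem_digitDual h.two_le hB hp hD hR0 hR hord hx]
  exact (h.image_mul hcop hp.ne_zero).isSpectralPair hB (Finset.mem_image.2 ⟨0, hL, mul_zero _⟩)

theorem pow_clog_le_mul_rpow_logb (hN : 1 < N) {M : ℝ} (hM : 1 ≤ M) {n : ℕ} (hn : n ≠ 0) :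
    M ^ Nat.clog N n ≤ M * (n : ℝ) ^ Real.logb N M := by
  have hN1 : (1 : ℝ) < N := Nat.one_lt_cast.2 hN
  have hn1 : (1 : ℝ) ≤ n := Nat.one_le_cast.2 (Nat.one_le_iff_ne_zero.2 hn)
  have hσ : 0 ≤ Real.logb N M := Real.logb_nonneg hN1 hM
  rcases hk : Nat.clog N n with _ | k
  · rw [pow_zero]
    exact one_le_mul_of_one_le_of_one_le hM (Real.one_le_rpow hn1 hσ)
  · have hkn : (N : ℝ) ^ k ≤ n := by
      exact_mod_cast ((Nat.lt_clog_iff_pow_lt hN).1 (k.lt_succ_self.trans_eq hk.symm)).le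
    rw [pow_succ']
    gcongr
    calc M ^ k = ((N : ℝ) ^ Real.logb N M) ^ k := by
          rw [Real.rpow_logb (by positivity) hN1.ne' (by positivity)]
      _ = ((N : ℝ) ^ k) ^ Real.logb N M := Real.rpow_pow_comm (by positivity) _ _
      _ ≤ (n : ℝ) ^ Real.logb N M := by gcongr

theorem eventually_pow_clog_mul_lt_rpow (hN : 1 < N) {M κ θ : ℝ} (hM : 1 ≤ M) (hκ : 0 ≤ κ)
    (hθ : Real.logb N M < θ) : ∀ᶠ n : ℕ in atTop, M ^ Nat.clog N n * κ < (n : ℝ) ^ θ := by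
  have hlim : Tendsto (fun n : ℕ => (n : ℝ) ^ (θ - Real.logb N M)) atTop atTop :=
    (tendsto_rpow_atTop (sub_pos.2 hθ)).comp tendsto_natCast_atTop_atTop
  filter_upwards [hlim.eventually_gt_atTop (M * κ), eventually_ne_atTop 0] with n hn hn0
  have hn1 : (0 : ℝ) < n := by positivity
  calc M ^ Nat.clog N n * κ ≤ M * (n : ℝ) ^ Real.logb N M * κ := by
        gcongr
        exact pow_clog_le_mul_rpow_logb hN hM hn0
    _ = M * κ * (n : ℝ) ^ Real.logb N M := by ring
    _ < (n : ℝ) ^ (θ - Real.logb N M) * (n : ℝ) ^ Real.logb N M := by gcongr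
    _ = (n : ℝ) ^ θ := by rw [← Real.rpow_add hn1, sub_add_cancel]

theorem IsHadamardTriple.infinite_setOf_isSpectralEigenvalue (h : IsHadamardTriple N B L)
    (hB : (0 : ℤ) ∈ B) (hL : (0 : ℤ) ∈ L) {θ : ℝ} (hθ : Real.logb N B.card < θ)
    (hord : {p : ℕ | p.Prime ∧ (p : ℝ) ^ θ ≤ orderOf (N : ZMod p)}.Infinite) :
    {p : ℕ | p.Prime ∧ IsSpectralEigenvalue (selfSimilarMeasure N B)
      (canonicalSpectrum N B L) (p : ℝ)}.Infinite := by
  have hsum (S : Finset ℤ) : ∀ s ∈ S, |(s : ℝ)| ≤ ∑ s ∈ S, |(s : ℝ)| := fun s hs =>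
    Finset.single_le_sum (f := fun s : ℤ => |(s : ℝ)|) (fun _ _ => abs_nonneg _) hs
  have hM : (1 : ℝ) ≤ L.card := Nat.one_le_cast.2 (Finset.card_pos.2 ⟨0, hL⟩)
  rw [h.card_eq] at hθ
  have hev := eventually_pow_clog_mul_lt_rpow (κ := 2 * ((∑ b ∈ B, |(b : ℝ)|) *
    ∑ l ∈ L, |(l : ℝ)|) + 1) (one_lt_two.trans_le h.two_le) hM (by positivity) hθ
  refine Nat.frequently_atTop_iff_infinite.1
    (((Nat.frequently_atTop_iff_infinite.2 hord).and_eventually hev).mono ?_)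
  rintro p ⟨⟨hp, hθp⟩, hlt⟩
  exact ⟨hp, h.isSpectralEigenvalue_of_lt_orderOf hB hL (hsum B) (hsum L) hp (hlt.trans_le hθp)⟩

end Multiples

/-! ### Large multiplicative orders from Artin's conjecture -/

theorem exists_eq_pow_two_pow_not_isSquare {N : ℕ} (hN : 2 ≤ N) :
    ∃ a j : ℕ, 2 ≤ a ∧ ¬ IsSquare a ∧ N = a ^ 2 ^ j := by
  induction N using Nat.strong_induction_on with
  | _ N ih =>
    by_cases hsq : IsSquare N
    · obtain ⟨r, rfl⟩ := hsq
      have hr : 2 ≤ r := by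
        by_contra! hr
        interval_cases r <;> omega
      obtain ⟨a, j, ha, hns, hr'⟩ := ih r (by nlinarith) hr
      refine ⟨a, j + 1, ha, hns, ?_⟩
      rw [hr', ← pow_add, pow_succ, mul_two]
    · exact ⟨N, 0, hN, hsq, by rw [pow_zero, pow_one]⟩

theorem orderOf_le_mul_orderOf_pow {G : Type*} [Monoid G] (x : G) {k : ℕ} (hk : k ≠ 0) :
    orderOf x ≤ k * orderOf (x ^ k) := by
  rcases (orderOf x).eq_zero_or_pos with h0 | hpos
  · exact h0 ▸ Nat.zero_le _
  · refine Nat.le_of_dvd (mul_pos hk.bot_lt (Nat.pos_of_dvd_of_pos (orderOf_pow_dvd k) hpos))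
      (orderOf_dvd_of_pow_eq_one ?_)
    rw [pow_mul, pow_orderOf_eq_one]

theorem ArtinPrimitiveRootConjecture.infinite_rpow_le_orderOf (h : ArtinPrimitiveRootConjecture)
    {N : ℕ} (hN : 2 ≤ N) {θ : ℝ} (hθ : θ < 1) :
    {p : ℕ | p.Prime ∧ (p : ℝ) ^ θ ≤ orderOf (N : ZMod p)}.Infinite := by
  obtain ⟨a, j, ha, hns, rfl⟩ := exists_eq_pow_two_pow_not_isSquare hN
  set k := 2 ^ j
  have hk : k ≠ 0 := by positivity
  have hlim : Tendsto (fun p : ℕ => (p : ℝ) ^ (1 - θ)) atTop atTop :=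
    (tendsto_rpow_atTop (sub_pos.2 hθ)).comp tendsto_natCast_atTop_atTop
  refine Nat.frequently_atTop_iff_infinite.1 (((Nat.frequently_atTop_iff_infinite.2
    (h a ha hns)).and_eventually (hlim.eventually_ge_atTop (2 * k))).mono ?_)
  rintro p ⟨⟨hp, -, hord⟩, hpk⟩
  refine ⟨hp, le_of_mul_le_mul_right ?_ (by positivity : (0 : ℝ) < 2 * k)⟩
  have hp0 : (0 : ℝ) < p := Nat.cast_pos.2 hp.pos
  have hle : p ≤ 2 * (k * orderOf ((a : ZMod p) ^ k)) := by
    have := orderOf_le_mul_orderOf_pow (a : ZMod p) hk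
    have := hp.two_le
    omega
  calc (p : ℝ) ^ θ * (2 * k) ≤ (p : ℝ) ^ θ * (p : ℝ) ^ (1 - θ) := by gcongr
    _ = p := by rw [← Real.rpow_add hp0, add_sub_cancel, Real.rpow_one]
    _ ≤ 2 * (k * orderOf ((a : ZMod p) ^ k)) := by exact_mod_cast hle
    _ = orderOf ((a ^ k : ℕ) : ZMod p) * (2 * k) := by push_cast; ring

/-! ### Large multiplicative orders from the Elliott–Halberstam conjecture -/

theorem eventually_mul_log_pow_le_rpow (c : ℝ) (k : ℕ) {s : ℝ} (hs : 0 < s) :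
    ∀ᶠ n : ℕ in atTop, c * Real.log n ^ k ≤ (n : ℝ) ^ s := by
  have hlittle := ((isLittleO_log_rpow_rpow_atTop k hs).const_mul_left c).bound one_pos
  filter_upwards [tendsto_natCast_atTop_atTop.eventually hlittle] with n hn
  rw [one_mul, Real.rpow_natCast, Real.norm_of_nonneg (Real.rpow_nonneg n.cast_nonneg s)] at hn
  exact (Real.le_norm_self _).trans hn

theorem eventually_div_two_le_primeCounting_mul_log :
    ∀ᶠ n : ℕ in atTop, (n : ℝ) / 2 ≤ Nat.primeCounting n * Real.log n := by
  filter_upwards [(tendsto_add_atTop_nat 1).eventually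
    (eventually_mul_log_pow_le_rpow 20 1 one_pos), eventually_ge_atTop 1] with n hlog hn
  rw [pow_one, Real.rpow_one, Nat.cast_add_one] at hlog
  have hn1 : (1 : ℝ) ≤ n := Nat.one_le_cast.2 hn
  nlinarith [Chebyshev.psi_ge n, Chebyshev.psi_le_primeCounting_mul_log n, Real.log_two_gt_d9]

theorem eventually_floor_rpow_div_four_le_card {α β : ℝ} (hβ : 0 < β) (hβ1 : β ≤ 1)
    (hαβ : α < β) : ∀ᶠ X : ℕ in atTop, (⌊(X : ℝ) ^ β⌋₊ : ℝ) / 4 ≤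
      ((Nat.primesLE ⌊(X : ℝ) ^ β⌋₊).filter fun q : ℕ => (X : ℝ) ^ α < q).card * Real.log X := by
  have hpow : Tendsto (fun X : ℕ => (X : ℝ) ^ β) atTop atTop :=
    (tendsto_rpow_atTop hβ).comp tendsto_natCast_atTop_atTop
  filter_upwards [(tendsto_nat_floor_atTop.comp hpow).eventually
      eventually_div_two_le_primeCounting_mul_log,
    eventually_mul_log_pow_le_rpow 8 1 (sub_pos.2 hαβ), hpow.eventually_ge_atTop 2,
    eventually_ge_atTop 1] with X hcheb hlog hXβ hX
  have hX1 : (1 : ℝ) ≤ X := Nat.one_le_cast.2 hX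
  have : 0 ≤ Real.log X := Real.log_nonneg hX1
  set Q := ⌊(X : ℝ) ^ β⌋₊
  have hQle : (Q : ℝ) ≤ X := (Nat.floor_le (by positivity)).trans
    (Real.rpow_le_self_of_one_le hX1 hβ1)
  have hQge : (X : ℝ) ^ β < Q + 1 := Nat.lt_floor_add_one _
  set s := (Nat.primesLE Q).filter fun q : ℕ => (X : ℝ) ^ α < q
  have hcard : (Nat.primeCounting Q : ℝ) ≤ s.card + X ^ α := by
    have hsub : Nat.primesLE Q ⊆ s ∪ Finset.Icc 1 ⌊(X : ℝ) ^ α⌋₊ := fun q hq => by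
      refine Finset.mem_union.2 ((lt_or_ge ((X : ℝ) ^ α) q).imp
        (fun hlt => Finset.mem_filter.2 ⟨hq, hlt⟩) fun hle => ?_)
      exact Finset.mem_Icc.2 ⟨(Nat.prime_of_mem_primesLE hq).one_le, Nat.le_floor hle⟩
    have hle := (Finset.card_le_card hsub).trans (Finset.card_union_le _ _)
    rw [Nat.primesLE_card_eq_primeCounting, Nat.card_Icc, Nat.add_sub_cancel] at hle
    calc (Nat.primeCounting Q : ℝ) ≤ s.card + ⌊(X : ℝ) ^ α⌋₊ := by exact_mod_cast hle
      _ ≤ s.card + X ^ α := by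
        gcongr
        exact Nat.floor_le (by positivity)
  have hsmall : 8 * ((X : ℝ) ^ α * Real.log X) ≤ X ^ β := by
    calc 8 * ((X : ℝ) ^ α * Real.log X) = X ^ α * (8 * Real.log X ^ 1) := by ring
      _ ≤ X ^ α * X ^ (β - α) := by gcongr
      _ = X ^ β := by rw [← Real.rpow_add (by positivity), add_sub_cancel]
  have hmain : (Q : ℝ) / 2 ≤ (s.card + X ^ α) * Real.log X := by
    calc (Q : ℝ) / 2 ≤ Nat.primeCounting Q * Real.log Q := hcheb
      _ ≤ (s.card + X ^ α) * Real.log X := by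
        have hQ0 : (0 : ℝ) < Q := by linarith
        gcongr
  linarith

theorem primeCountingAP_le (y : ℝ) (q : ℕ) (a : ℤ) : primeCountingAP y q a ≤ ⌊y⌋₊ + 1 := by
  rw [primeCountingAP, ← Finset.card_range (⌊y⌋₊ + 1), ← Set.ncard_coe_finset]
  refine Set.ncard_le_ncard (fun p hp => ?_) (Finset.finite_toSet _)
  exact Finset.mem_coe.2 (Finset.mem_range_succ_iff.2 (Nat.le_floor hp.2.1))

theorem apError_nonneg (x : ℝ) (q : ℕ) : 0 ≤ apError x q :=
  Real.sSup_nonneg fun _ ⟨_, _, _, _, hr⟩ => hr ▸ abs_nonneg _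

theorem abs_sub_le_apError {x y : ℝ} (hyx : y ≤ x) {q : ℕ} {a : ℤ} (ha : IsCoprime a (q : ℤ)) :
    |(primeCountingAP y q a : ℝ) - Nat.primeCounting ⌊y⌋₊ / Nat.totient q| ≤ apError x q := by
  refine le_csSup ⟨⌊x⌋₊ + 1, ?_⟩ ⟨y, a, hyx, ha, rfl⟩
  rintro _ ⟨y, a, hy, -, rfl⟩
  have hfloor : (⌊y⌋₊ + 1 : ℝ) ≤ ⌊x⌋₊ + 1 := by exact_mod_cast Nat.succ_le_succ (Nat.floor_mono hy)
  have hAP : (primeCountingAP y q a : ℝ) ≤ ⌊y⌋₊ + 1 := by exact_mod_cast primeCountingAP_le y q a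
  have hdiv : (Nat.primeCounting ⌊y⌋₊ : ℝ) / Nat.totient q ≤ ⌊y⌋₊ + 1 := by
    have hπ : (Nat.primeCounting ⌊y⌋₊ : ℝ) ≤ ⌊y⌋₊ + 1 := by
      exact_mod_cast Nat.count_le (p := Nat.Prime) (n := ⌊y⌋₊ + 1)
    rcases (Nat.totient q).eq_zero_or_pos with h0 | hpos
    · rw [h0, Nat.cast_zero, div_zero]
      positivity
    · exact (div_le_self (Nat.cast_nonneg _) (Nat.one_le_cast.2 hpos)).trans hπ
  exact abs_sub_le_of_nonneg_of_le (Nat.cast_nonneg _) (hAP.trans hfloor) (by positivity)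
    (hdiv.trans hfloor)

theorem card_mul_primeCounting_div_le (X : ℕ) {Q : ℕ} {s : Finset ℕ} (hs : s ⊆ Finset.Icc 1 Q) :
    s.card * ((Nat.primeCounting X : ℝ) / Q) ≤
      ∑ q ∈ s, (primeCountingAP X q 1 : ℝ) + ∑ q ∈ Finset.Icc 1 Q, apError X q := by
  have hterm : ∀ q ∈ s, (Nat.primeCounting X : ℝ) / Q ≤ primeCountingAP X q 1 + apError X q := by
    intro q hq
    obtain ⟨hq1, hqQ⟩ := Finset.mem_Icc.1 (hs hq)
    have : (0 : ℝ) < Nat.totient q := Nat.cast_pos.2 (Nat.totient_pos.2 hq1)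
    have hφQ : (Nat.totient q : ℝ) ≤ Q := Nat.cast_le.2 ((Nat.totient_le q).trans hqQ)
    have herr := (abs_le.1 (abs_sub_le_apError (le_refl (X : ℝ))
      (isCoprime_one_left (x := (q : ℤ))))).1
    rw [Nat.floor_natCast] at herr
    have hdiv : (Nat.primeCounting X : ℝ) / Q ≤ Nat.primeCounting X / Nat.totient q := by gcongr
    linarith
  calc s.card * ((Nat.primeCounting X : ℝ) / Q)
      ≤ ∑ q ∈ s, (primeCountingAP X q 1 + apError X q) := by
        rw [← nsmul_eq_mul]
        exact Finset.card_nsmul_le_sum _ _ _ hterm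
    _ ≤ _ := by
        rw [Finset.sum_add_distrib]
        gcongr
        exact fun q _ _ => apError_nonneg X q

open Classical in
/-- The primes `p ≤ X` such that `p - 1` has a prime factor larger than `X ^ α`. For such `p` the
order modulo `p` of an integer prime to `p` is larger than `X ^ α` or at most `X ^ (1 - α)`. -/
noncomputable def primesWithLargeFactor (α : ℝ) (X : ℕ) : Finset ℕ :=
  (Nat.primesLE X).filter fun p => ∃ q : ℕ, q.Prime ∧ (X : ℝ) ^ α < q ∧ q ∣ p - 1

theorem mem_primesWithLargeFactor {α : ℝ} {X p : ℕ} : p ∈ primesWithLargeFactor α X ↔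
    p ∈ Nat.primesLE X ∧ ∃ q : ℕ, q.Prime ∧ (X : ℝ) ^ α < q ∧ q ∣ p - 1 := by
  classical exact Finset.mem_filter

theorem primeCountingAP_natCast_one (X q : ℕ) :
    primeCountingAP X q 1 = ((Nat.primesLE X).filter fun p => q ∣ p - 1).card := by
  rw [primeCountingAP, ← Set.ncard_coe_finset]
  congr 1
  ext p
  rw [Finset.mem_coe, Finset.mem_filter, Nat.mem_primesLE, and_comm (a := p ≤ X), and_assoc]
  refine and_congr_right fun hp => and_congr Nat.cast_le ?_
  rw [Int.modEq_comm, Int.modEq_iff_dvd, ← Int.natCast_dvd_natCast, Nat.cast_sub hp.one_le,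
    Nat.cast_one]

theorem eq_of_prime_dvd_of_lt_mul {m q q' : ℕ} (hm : m ≠ 0) (hq : q.Prime) (hq' : q'.Prime)
    (hqm : q ∣ m) (hqm' : q' ∣ m) (hlt : m < q * q') : q = q' := by
  by_contra hne
  exact hlt.not_ge (Nat.le_of_dvd hm.bot_lt
    (((Nat.coprime_primes hq hq').2 hne).mul_dvd_of_dvd_of_dvd hqm hqm'))

theorem sum_primeCountingAP_le_card {α : ℝ} (hα : 1 / 2 ≤ α) {X : ℕ} {s : Finset ℕ}
    (hs : ∀ q ∈ s, q.Prime ∧ (X : ℝ) ^ α < q) :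
    ∑ q ∈ s, primeCountingAP X q 1 ≤ (primesWithLargeFactor α X).card := by
  classical
  simp_rw [primeCountingAP_natCast_one]
  rw [← Finset.card_biUnion]
  · refine Finset.card_le_card fun p hp => ?_
    obtain ⟨q, hq, hpq⟩ := Finset.mem_biUnion.1 hp
    obtain ⟨hpX, hdvd⟩ := Finset.mem_filter.1 hpq
    exact mem_primesWithLargeFactor.2 ⟨hpX, q, (hs q hq).1, (hs q hq).2, hdvd⟩
  · refine fun q hq q' hq' hne => Finset.disjoint_left.2 fun p hp hp' => hne ?_
    obtain ⟨hpX, hdvd⟩ := Finset.mem_filter.1 hp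
    have hp2 := (Nat.mem_primesLE.1 hpX).2.two_le
    have hpX := (Nat.mem_primesLE.1 hpX).1
    have hX1 : (1 : ℝ) ≤ X := Nat.one_le_cast.2 (by omega)
    have hlt : (X : ℝ) < (q * q' : ℕ) := by
      calc (X : ℝ) ≤ (X : ℝ) ^ (α + α) := Real.self_le_rpow_of_one_le hX1 (by linarith)
        _ = (X : ℝ) ^ α * (X : ℝ) ^ α := Real.rpow_add (by positivity) _ _
        _ < (q * q' : ℕ) := by
          push_cast
          exact mul_lt_mul'' (hs q hq).2 (hs q' hq').2 (by positivity) (by positivity)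
    refine eq_of_prime_dvd_of_lt_mul (by omega) (hs q hq).1 (hs q' hq').1 hdvd
      (Finset.mem_filter.1 hp').2 (lt_of_lt_of_le ?_ (Nat.cast_lt.1 hlt).le)
    omega

theorem ElliottHalberstamConjecture.eventually_div_le_card_mul_log_sq
    (h : ElliottHalberstamConjecture) {α : ℝ} (hα : 1 / 2 ≤ α) (hα1 : α < 1) :
    ∀ᶠ X : ℕ in atTop,
      (X : ℝ) / 16 ≤ (primesWithLargeFactor α X).card * Real.log X ^ 2 := by
  obtain ⟨β, hαβ, hβ1⟩ := exists_between hα1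
  have hβ : 0 < β := by linarith
  obtain ⟨C, -, hC⟩ := h β hβ hβ1 3 three_pos
  have hlog : Tendsto (fun X : ℕ => Real.log X) atTop atTop :=
    Real.tendsto_log_atTop.comp tendsto_natCast_atTop_atTop
  filter_upwards [eventually_div_two_le_primeCounting_mul_log,
    eventually_floor_rpow_div_four_le_card hβ hβ1.le hαβ,
    hlog.eventually_ge_atTop (16 * C), eventually_gt_atTop 2] with X hπ hcard hlogC hX
  have hX2 : (2 : ℝ) < X := Nat.ofNat_lt_cast.2 hX
  have hlog0 : 0 < Real.log X := Real.log_pos (by linarith)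
  have hsum := hC X hX2
  set Q := ⌊(X : ℝ) ^ β⌋₊
  have hQ : 0 < (Q : ℝ) := Nat.cast_pos.2
    (Nat.floor_pos.2 (Real.one_le_rpow (by linarith) hβ.le))
  set s := (Nat.primesLE Q).filter fun q : ℕ => (X : ℝ) ^ α < q
  have hs : ∀ q ∈ s, q.Prime ∧ (X : ℝ) ^ α < q := fun q hq =>
    ⟨Nat.prime_of_mem_primesLE (Finset.mem_filter.1 hq).1, (Finset.mem_filter.1 hq).2⟩
  have hsQ : s ⊆ Finset.Icc 1 Q := fun q hq => Finset.mem_Icc.2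
    ⟨(hs q hq).1.one_le, (Nat.mem_primesLE.1 (Finset.mem_filter.1 hq).1).1⟩
  have hlower : (X : ℝ) / 8 ≤ s.card * (Nat.primeCounting X / Q) * Real.log X ^ 2 := by
    calc (X : ℝ) / 8 = Q / 4 * (X / 2) / Q := by field_simp; norm_num
      _ ≤ (s.card * Real.log X) * (Nat.primeCounting X * Real.log X) / Q := by gcongr
      _ = s.card * (Nat.primeCounting X / Q) * Real.log X ^ 2 := by ring
  have herror : C * X / Real.log X ^ (3 : ℝ) * Real.log X ^ 2 ≤ X / 16 := by
    rw [← Nat.cast_three, Real.rpow_natCast, pow_succ _ 2, ← div_div, div_right_comm,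
      div_mul_cancel₀ _ (by positivity), div_le_iff₀ hlog0]
    nlinarith
  have hupper : ∑ q ∈ s, (primeCountingAP X q 1 : ℝ) ≤ (primesWithLargeFactor α X).card := by
    exact_mod_cast sum_primeCountingAP_le_card hα hs
  have hcombined : s.card * ((Nat.primeCounting X : ℝ) / Q) ≤
      (primesWithLargeFactor α X).card + C * X / Real.log X ^ (3 : ℝ) :=
    (card_mul_primeCounting_div_le X hsQ).trans (add_le_add hupper hsum)
  have hscaled := mul_le_mul_of_nonneg_right hcombined (sq_nonneg (Real.log X))
  rw [add_mul] at hscaled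
  linarith

theorem card_primeFactors_pow_sub_one_le {N : ℕ} (hN : 2 ≤ N) {k : ℕ} (hk : k ≠ 0) :
    (N ^ k - 1).primeFactors.card ≤ N * k := by
  have hpos : 0 < N ^ k - 1 := Nat.sub_pos_of_lt (Nat.one_lt_pow hk hN)
  refine (Nat.pow_le_pow_iff_right one_lt_two).1 ?_
  calc 2 ^ (N ^ k - 1).primeFactors.card ≤ ∏ p ∈ (N ^ k - 1).primeFactors, p :=
        Finset.pow_card_le_prod _ _ _ fun p hp => (Nat.prime_of_mem_primeFactors hp).two_le
    _ ≤ N ^ k - 1 := Nat.le_of_dvd hpos (Nat.prod_primeFactors_dvd _)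
    _ ≤ N ^ k := Nat.sub_le _ _
    _ ≤ (2 ^ N) ^ k := Nat.pow_le_pow_left Nat.lt_two_pow_self.le k
    _ = 2 ^ (N * k) := (pow_mul 2 N k).symm

theorem card_le_mul_sq_of_orderOf_le {N K : ℕ} (hN : 2 ≤ N) {s : Finset ℕ}
    (hs : ∀ p ∈ s, p.Prime ∧ orderOf (N : ZMod p) ≠ 0 ∧ orderOf (N : ZMod p) ≤ K) :
    s.card ≤ N * K ^ 2 := by
  have hsub : s ⊆ (Finset.Icc 1 K).biUnion fun k => (N ^ k - 1).primeFactors := by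
    intro p hp
    obtain ⟨hpp, hne, hle⟩ := hs p hp
    have hlt := Nat.one_lt_pow hne hN
    refine Finset.mem_biUnion.2 ⟨orderOf (N : ZMod p),
      Finset.mem_Icc.2 ⟨Nat.one_le_iff_ne_zero.2 hne, hle⟩,
      Nat.mem_primeFactors.2 ⟨hpp, ?_, (Nat.sub_pos_of_lt hlt).ne'⟩⟩
    rw [← ZMod.natCast_eq_zero_iff, Nat.cast_sub hlt.le, Nat.cast_pow, pow_orderOf_eq_one,
      Nat.cast_one, sub_self]
  calc s.card ≤ ∑ k ∈ Finset.Icc 1 K, (N ^ k - 1).primeFactors.card :=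
        (Finset.card_le_card hsub).trans Finset.card_biUnion_le
    _ ≤ (Finset.Icc 1 K).card • (N * K) := Finset.sum_le_card_nsmul _ _ _ fun k hk => by
        obtain ⟨hk1, hkK⟩ := Finset.mem_Icc.1 hk
        exact (card_primeFactors_pow_sub_one_le hN (by omega)).trans (Nat.mul_le_mul_left N hkK)
    _ = N * K ^ 2 := by
        rw [Nat.card_Icc, Nat.add_sub_cancel, smul_eq_mul]
        ring

theorem orderOf_mul_le_of_prime_dvd {p q : ℕ} [Fact p.Prime] (hq : q.Prime) (hdvd : q ∣ p - 1)
    {u : ZMod p} (hu : u ≠ 0) (hlt : orderOf u < q) : orderOf u * q ≤ p - 1 := by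
  have hord : orderOf u ∣ p - 1 := ZMod.orderOf_dvd_card_sub_one hu
  have hp : 0 < p - 1 := Nat.sub_pos_of_lt (Fact.out : p.Prime).one_lt
  have hcop : (orderOf u).Coprime q := (hq.coprime_iff_not_dvd.2 fun hqu =>
    (Nat.le_of_dvd (Nat.pos_of_dvd_of_pos hord hp) hqu).not_gt hlt).symm
  exact Nat.le_of_dvd hp (hcop.mul_dvd_of_dvd_of_dvd hord hdvd)

theorem lt_of_mem_primesWithLargeFactor {α : ℝ} {X p : ℕ} (hp : p ∈ primesWithLargeFactor α X) :
    (X : ℝ) ^ α < p := by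
  obtain ⟨hpX, q, -, hlt, hdvd⟩ := mem_primesWithLargeFactor.1 hp
  have hp1 := (Nat.prime_of_mem_primesLE hpX).one_lt
  exact hlt.trans_le (Nat.cast_le.2
    ((Nat.le_of_dvd (Nat.sub_pos_of_lt hp1) hdvd).trans (Nat.sub_le _ _)))

theorem orderOf_le_rpow_one_sub {N : ℕ} (hN : N ≠ 0) {α : ℝ} {X p : ℕ}
    (hNX : (N : ℝ) ≤ (X : ℝ) ^ α) (hp : p ∈ primesWithLargeFactor α X)
    (hord : (orderOf (N : ZMod p) : ℝ) ≤ (X : ℝ) ^ α) :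
    orderOf (N : ZMod p) ≠ 0 ∧ (orderOf (N : ZMod p) : ℝ) ≤ (X : ℝ) ^ (1 - α) := by
  obtain ⟨hpX, q, hq, hlt, hdvd⟩ := mem_primesWithLargeFactor.1 hp
  obtain ⟨hpX, hpp⟩ := Nat.mem_primesLE.1 hpX
  have := Fact.mk hpp
  have hX0 : (0 : ℝ) < X := Nat.cast_pos.2 (hpp.pos.trans_le hpX)
  have hu : (N : ZMod p) ≠ 0 := fun h0 =>
    (Nat.cast_le.2 (Nat.le_of_dvd hN.bot_lt ((ZMod.natCast_eq_zero_iff N p).1 h0))).not_gt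
      (hNX.trans_lt (lt_of_mem_primesWithLargeFactor hp))
  refine ⟨fun h0 => ?_, ?_⟩
  · have hdvd0 := h0 ▸ ZMod.orderOf_dvd_card_sub_one hu
    exact (Nat.sub_pos_of_lt hpp.one_lt).ne' (zero_dvd_iff.1 hdvd0)
  · have hmul := orderOf_mul_le_of_prime_dvd hq hdvd hu (Nat.cast_lt.1 (hord.trans_lt hlt))
    rw [Real.rpow_sub hX0, Real.rpow_one, le_div_iff₀ (by positivity)]
    calc (orderOf (N : ZMod p) : ℝ) * X ^ α ≤ orderOf (N : ZMod p) * q := by gcongr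
      _ ≤ X := by exact_mod_cast hmul.trans ((Nat.sub_le _ _).trans hpX)

theorem card_filter_orderOf_le {N : ℕ} (hN : 2 ≤ N) {α : ℝ} {X : ℕ}
    (hNX : (N : ℝ) ≤ (X : ℝ) ^ α) :
    (((primesWithLargeFactor α X).filter
      fun p => (orderOf (N : ZMod p) : ℝ) ≤ (X : ℝ) ^ α).card : ℝ) ≤
        N * ((X : ℝ) ^ (1 - α)) ^ 2 := by
  have hcard := card_le_mul_sq_of_orderOf_le (K := ⌊(X : ℝ) ^ (1 - α)⌋₊) hN (s :=
    (primesWithLargeFactor α X).filter fun p => (orderOf (N : ZMod p) : ℝ) ≤ (X : ℝ) ^ α)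
    fun p hp => by
      obtain ⟨hpl, hord⟩ := Finset.mem_filter.1 hp
      obtain ⟨hne, hle⟩ := orderOf_le_rpow_one_sub (two_pos.trans_le hN).ne' hNX hpl hord
      exact ⟨Nat.prime_of_mem_primesLE (mem_primesWithLargeFactor.1 hpl).1, hne, Nat.le_floor hle⟩
  calc _ ≤ (N : ℝ) * (⌊(X : ℝ) ^ (1 - α)⌋₊ : ℝ) ^ 2 := by exact_mod_cast hcard
    _ ≤ N * ((X : ℝ) ^ (1 - α)) ^ 2 := by
      gcongr
      exact Nat.floor_le (by positivity)

namespace ElliottHalberstamConjecture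

theorem eventually_exists_rpow_lt_orderOf (h : ElliottHalberstamConjecture) {N : ℕ} (hN : 2 ≤ N)
    {α : ℝ} (hα : 1 / 2 < α) (hα1 : α < 1) :
    ∀ᶠ X : ℕ in atTop, ∃ p : ℕ, p.Prime ∧ (X : ℝ) ^ α < p ∧ p ≤ X ∧
      (X : ℝ) ^ α < orderOf (N : ZMod p) := by
  have hpow : Tendsto (fun X : ℕ => (X : ℝ) ^ α) atTop atTop :=
    (tendsto_rpow_atTop (by linarith)).comp tendsto_natCast_atTop_atTop
  filter_upwards [h.eventually_div_le_card_mul_log_sq hα.le hα1,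
    eventually_mul_log_pow_le_rpow (32 * N) 2 (by linarith : 0 < 2 * α - 1),
    hpow.eventually_ge_atTop N, eventually_gt_atTop 0] with X hcard hlog hNX hX
  have hX0 : (0 : ℝ) < X := Nat.cast_pos.2 hX
  suffices ∃ p ∈ primesWithLargeFactor α X, (X : ℝ) ^ α < orderOf (N : ZMod p) by
    obtain ⟨p, hp, hlt⟩ := this
    obtain ⟨hpX, hpp⟩ := Nat.mem_primesLE.1 (mem_primesWithLargeFactor.1 hp).1
    exact ⟨p, hpp, lt_of_mem_primesWithLargeFactor hp, hpX, hlt⟩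
  by_contra! hall
  have hfew := card_filter_orderOf_le hN hNX
  rw [Finset.filter_true_of_mem hall] at hfew
  have hrpow : ((X : ℝ) ^ (1 - α)) ^ 2 * X ^ (2 * α - 1) = X := by
    rw [← Real.rpow_mul_natCast hX0.le, ← Real.rpow_add hX0, Nat.cast_two,
      show (1 - α) * 2 + (2 * α - 1) = 1 by ring, Real.rpow_one]
  have hle : (X : ℝ) / 16 ≤ X / 32 := by
    calc (X : ℝ) / 16 ≤ (primesWithLargeFactor α X).card * Real.log X ^ 2 := hcard
      _ ≤ N * ((X : ℝ) ^ (1 - α)) ^ 2 * Real.log X ^ 2 := by gcongr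
      _ = ((X : ℝ) ^ (1 - α)) ^ 2 * (32 * N * Real.log X ^ 2) / 32 := by ring
      _ ≤ ((X : ℝ) ^ (1 - α)) ^ 2 * X ^ (2 * α - 1) / 32 := by gcongr
      _ = X / 32 := by rw [hrpow]
  linarith

theorem infinite_rpow_le_orderOf (h : ElliottHalberstamConjecture) {N : ℕ} (hN : 2 ≤ N) {θ : ℝ}
    (hθ : θ < 1) : {p : ℕ | p.Prime ∧ (p : ℝ) ^ θ ≤ orderOf (N : ZMod p)}.Infinite := by
  obtain ⟨α, hα, hα1⟩ := exists_between (max_lt hθ one_half_lt_one)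
  obtain ⟨hθα, hα⟩ := max_lt_iff.1 hα
  have hpow : Tendsto (fun X : ℕ => (X : ℝ) ^ α) atTop atTop :=
    (tendsto_rpow_atTop (one_half_pos.trans hα)).comp tendsto_natCast_atTop_atTop
  refine Set.infinite_of_forall_exists_gt fun P => ?_
  obtain ⟨X, ⟨p, hp, hlt, hpX, hord⟩, hPX⟩ :=
    ((h.eventually_exists_rpow_lt_orderOf hN hα hα1).and (hpow.eventually_ge_atTop P)).exists
  refine ⟨p, ⟨hp, ?_⟩, Nat.cast_lt.1 (hPX.trans_lt hlt)⟩
  calc (p : ℝ) ^ θ ≤ (p : ℝ) ^ α :=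
        Real.rpow_le_rpow_of_exponent_le (Nat.one_le_cast.2 hp.one_le) hθα.le
    _ ≤ (X : ℝ) ^ α := by gcongr
    _ ≤ orderOf (N : ZMod p) := hord.le

end ElliottHalberstamConjecture

theorem theorem2 (hconj : ArtinPrimitiveRootConjecture ∨ ElliottHalberstamConjecture)
    (N : ℕ) (B L : Finset ℤ) (hT : IsHadamardTriple N B L) (hB0 : (0 : ℤ) ∈ B)
    (hL0 : (0 : ℤ) ∈ L) :
    (IsSingularContinuous (selfSimilarMeasure N B) ↔ B.card < N) ∧
      (IsSingularContinuous (selfSimilarMeasure N B) →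
        {p : ℕ | p.Prime ∧ IsSpectralEigenvalue (selfSimilarMeasure N B)
          (canonicalSpectrum N B L) (p : ℝ)}.Infinite) := by
  have hiff := isSingularContinuous_selfSimilarMeasure_iff hT
  refine ⟨hiff, fun hs => ?_⟩
  have hcard : Real.logb N B.card < 1 := by
    have hN : (1 : ℝ) < N := Nat.one_lt_cast.2 hT.two_le
    have hB : (0 : ℝ) < B.card := Nat.cast_pos.2 (Finset.card_pos.2 ⟨0, hB0⟩)
    rw [Real.logb_lt_iff_lt_rpow hN hB, Real.rpow_one]
    exact_mod_cast hiff.1 hs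
  obtain ⟨θ, hθ, hθ1⟩ := exists_between hcard
  refine hT.infinite_setOf_isSpectralEigenvalue hB0 hL0 hθ ?_
  rcases hconj with hA | hE
  · exact hA.infinite_rpow_le_orderOf hT.two_le hθ1
  · exact hE.infinite_rpow_le_orderOf hT.two_le hθ1
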